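/- Let $\mathcal B$ be a braided monoidal category with braiding $c$, and let $(H,\delta)$ be a strong coendomorphism object of $\mathcal B$: an object $H$ with a natural transformation $\delta_X\colon X\to X\otimes H$ such that for all $P,T\in\mathcal B$ the maps $$\mathcal B(H,T)\to \mathrm{Nat}(\mathrm{Id},\mathrm{Id}\otimes T),\ f\mapsto (X\otimes f)\delta_X,\qquad \mathcal B(H\otimes P,T)\to\mathrm{Nat}(-\otimes P,-\otimes T),\ f\mapsto (X\otimes f)(\delta_X\otimes P)$$ are bijections. Then $H$ carries a unique bialgebra structure $(\mu,\eta,\Delta,\varepsilon)$ in $\mathcal B$ for which every $\delta_X$ is a comodule structure, $\delta_{X\otimes Y}=(X\otimes Y\otimes \mu)(X\otimes c_{H,Y}\otimes H)(\delta_X\otimes\delta_Y)$ and $\delta_I=\eta$, and a unique half-braiding $\sigma_{Y}=\sigma_{H,Y}\colon H\otimes Y\to Y\otimes H$ with $(X\otimes\sigma_{Y})(\delta_X\otimes Y)=(c_{Y,X}\otimes H)(Y\otimes\delta_X)c_{X,Y}$; it makes $H$ an algebra in the Drinfeld center of $\mathcal B$. Assume that $H$ is a Hopf algebra, i.e. that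 it has an antipode. Let $A$ be an algebra in $\mathcal B$ and let $\mathcal B_A$ be the left $\mathcal B$-module category of right $A$-modules in $\mathcal B$, with $X\triangleright V=X\otimes V$. A module braiding on a left $\mathcal B$-module category $\mathcal M$ is a natural isomorphism $e_{X,V}\colon X\triangleright V\to X\triangleright V$ ($X\in\mathcal B$, $V\in\mathcal M$) with $$\text{(i)}\quad e_{X\otimes Y,V}=(X\triangleright e_{Y,V})(c_{Y,X}\triangleright V)(Y\triangleright e_{X,V})(c_{Y,X}^{-1}\triangleright V),$$ $$\text{(ii)}\quad e_{X,Y\triangleright V}=(c_{Y,X}\triangleright V)(Y\triangleright e_{X,V})(c_{X,Y}\triangleright V)$$ (associativity isomorphisms suppressed). The reflective center $\mathrm{refc}_{\mathcal B}(\mathcal M)$ is the category of pairs $(V,e_{-,V})$ with $V\in\mathcal M$ and $e_{X,V}\colon X\triangleright V\to X\triangleright V$ an isomorphism natural in $X$ with $e_{I,V}=\mathrm{id}$ and (i); its morphisms are the morphisms in $\mathcal M$ commuting with the $e$'s, and $\mathcal B$ acts on it by $Y\triangleright (V,e)=(Y\triangleright V,\,e_{-,Y\triangleright V})$ with $e_{-,Y\triangleright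 V}$ defined by (ii). Then: (1) The module braidings on $\mathcal B_A$ are in bijection with the algebra maps $f\colon H\to A$ satisfying $$\mu_A(f\otimes A)=\mu_A(A\otimes f)\sigma_{A}\colon H\otimes A\to A ,$$ where $f$ corresponds to the module braiding with components $$X\otimes V\xrightarrow{\ \delta_X\otimes V\ }X\otimes H\otimes V\xrightarrow{\ X\otimes\sigma_V\ }X\otimes V\otimes H\xrightarrow{\ X\otimes V\otimes f\ }X\otimes V\otimes A\to X\otimes V,$$ the last map being given by the action of $A$ on $V$. (2) Let $A\otimes_\sigma H$ be the algebra $A\otimes H$ in $\mathcal B$ with multiplication $(\mu_A\otimes\mu)(A\otimes\sigma_{A}\otimes H)$ and unit $\eta_A\otimes\eta$. There is an equivalence of left $\mathcal B$-module categories $$\mathcal B_{A\otimes_\sigma H}\simeq \mathrm{refc}_{\mathcal B}(\mathcal B_A)$$ which is compatible, up to an isomorphism of $\mathcal B$-module functors, with the restriction functor $\mathcal B_{A\otimes_\sigma H}\to\mathcal B_A$ along $A\to A\otimes_\sigma H$ and the forgetful functor $\mathrm{refc}_{\mathcal B}(\mathcal B_A)\to\mathcal B_A$, and under which the isomorphism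 $e_{X,M}$ for an $A\otimes_\sigma H$-module $M$ is the composite displayed in (1) with $V=M$, with $f$ replaced by the algebra map $H\to A\otimes_\sigma H$ and the action by that of $A\otimes_\sigma H$ on $M$. -/

import Mathlib

open CategoryTheory MonoidalCategory BraidedCategory
open scoped MonObj ComonObj

universe v u

set_option linter.unusedSectionVars false
set_option linter.style.longLine false

noncomputable section

section TwistedTensor

variable {B : Type u} [Category.{v} B] [MonoidalCategory B]

/-- Together with the half-braiding `τ`, the monoid `H` is a monoid in the Drinfeld center:
its unit and its multiplication are compatible with the half-braiding. -/
class CentralMonoid {H : B} [MonObj H] (τ : HalfBraiding H) : Prop where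
  one_comm : ∀ Y : B, η[H] ▷ Y ≫ (τ.β Y).hom = (λ_ Y).hom ≫ (ρ_ Y).inv ≫ Y ◁ η[H]
  mul_comm : ∀ Y : B, μ[H] ▷ Y ≫ (τ.β Y).hom =
    (α_ H H Y).hom ≫ H ◁ (τ.β Y).hom ≫ (α_ H Y H).inv ≫ (τ.β Y).hom ▷ H ≫
      (α_ Y H H).hom ≫ Y ◁ μ[H]

/-- The underlying object `A ⊗ H` of the tensor product algebra `A ⊗_τ H` twisted by a
half-braiding `τ` of `H`. -/
def TwistedTensor (A : B) {H : B} (_τ : HalfBraiding H) : B := A ⊗ H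

/-- The unit of `A ⊗_τ H`. -/
def twistedUnit (A H : B) [MonObj A] [MonObj H] : 𝟙_ B ⟶ A ⊗ H :=
  (λ_ _).inv ≫ (η[A] ⊗ₘ η[H])

/-- The multiplication `(μ ⊗ μ) ∘ (A ⊗ τ_A ⊗ H)` of `A ⊗_τ H`. -/
def twistedMul (A : B) [MonObj A] {H : B} [MonObj H] (τ : HalfBraiding H) :
    (A ⊗ H) ⊗ (A ⊗ H) ⟶ A ⊗ H :=
  (α_ A H (A ⊗ H)).hom ≫ A ◁ (α_ H A H).inv ≫ A ◁ (τ.β A).hom ▷ H ≫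
    A ◁ (α_ A H H).hom ≫ (α_ A A (H ⊗ H)).inv ≫ (μ[A] ⊗ₘ μ[H])

theorem halfBraiding_unit {H : B} (τ : HalfBraiding H) :
    (τ.β (𝟙_ B)).hom = (ρ_ H).hom ≫ (λ_ H).inv := by
  have h1 := τ.naturality (λ_ (𝟙_ B)).hom
  rw [τ.monoidal] at h1
  have h2 : ((ρ_ H).inv ≫ (τ.β (𝟙_ B)).hom ≫ (λ_ H).hom) ≫
      ((ρ_ H).inv ≫ (τ.β (𝟙_ B)).hom ≫ (λ_ H).hom) =
      (ρ_ H).inv ≫ (τ.β (𝟙_ B)).hom ≫ (λ_ H).hom := by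
    calc _ = (ρ_ H).inv ≫ H ◁ (λ_ (𝟙_ B)).inv ≫ (((α_ _ _ _).inv ≫ (τ.β (𝟙_ B)).hom ▷ 𝟙_ B ≫
            (α_ _ _ _).hom ≫ 𝟙_ B ◁ (τ.β (𝟙_ B)).hom ≫ (α_ _ _ _).inv) ≫
            (λ_ (𝟙_ B)).hom ▷ H) ≫ (λ_ H).hom := by monoidal
      _ = _ := by
        rw [← h1, Category.assoc, ← MonoidalCategory.whiskerLeft_comp_assoc, Iso.inv_hom_id,
          MonoidalCategory.whiskerLeft_id, Category.id_comp]
  have h3 : (ρ_ H).inv ≫ (τ.β (𝟙_ B)).hom ≫ (λ_ H).hom = 𝟙 _ := by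
    rwa [← cancel_epi ((ρ_ H).inv ≫ (τ.β (𝟙_ B)).hom ≫ (λ_ H).hom), Category.comp_id]
  rw [Iso.inv_comp_eq, Category.comp_id] at h3
  rw [← h3]; simp

variable (A : B) [MonObj A] {H : B} [MonObj H] (τ : HalfBraiding H) [CentralMonoid τ]

theorem twisted_one_mul : twistedUnit A H ▷ (A ⊗ H) ≫ twistedMul A τ = (λ_ (A ⊗ H)).hom := by
  unfold twistedUnit twistedMul
  rw [MonoidalCategory.tensorHom_def, MonoidalCategory.tensorHom_def]
  calc _ = 𝟙 _ ⊗≫ η[A] ▷ (𝟙_ B ⊗ A ⊗ H) ⊗≫ A ◁ (η[H] ▷ A ≫ (τ.β A).hom) ▷ H ⊗≫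
        (μ[A] ▷ (H ⊗ H) ≫ A ◁ μ[H]) := by monoidal
    _ = 𝟙 _ ⊗≫ η[A] ▷ (A ⊗ H) ⊗≫ ((A ⊗ A) ◁ (η[H] ▷ H) ≫ μ[A] ▷ (H ⊗ H)) ⊗≫ A ◁ μ[H] := by
        rw [CentralMonoid.one_comm]; monoidal
    _ = 𝟙 _ ⊗≫ (η[A] ▷ A ≫ μ[A]) ▷ H ⊗≫ A ◁ (η[H] ▷ H ≫ μ[H]) := by
        rw [whisker_exchange]; monoidal
    _ = _ := by rw [MonObj.one_mul, MonObj.one_mul]; monoidal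

theorem twisted_mul_one : (A ⊗ H) ◁ twistedUnit A H ≫ twistedMul A τ = (ρ_ (A ⊗ H)).hom := by
  unfold twistedUnit twistedMul
  rw [MonoidalCategory.tensorHom_def', MonoidalCategory.tensorHom_def]
  calc _ = 𝟙 _ ⊗≫ A ◁ H ◁ 𝟙_ B ◁ η[H] ⊗≫ A ◁ (H ◁ η[A] ≫ (τ.β A).hom) ▷ H ⊗≫
        (μ[A] ▷ (H ⊗ H) ≫ A ◁ μ[H]) := by monoidal
    _ = 𝟙 _ ⊗≫ A ◁ ((H ⊗ 𝟙_ B) ◁ η[H] ≫ ((ρ_ H).hom ≫ (λ_ H).inv) ▷ H) ⊗≫ A ◁ (η[A] ▷ H) ▷ H ⊗≫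
        (μ[A] ▷ (H ⊗ H) ≫ A ◁ μ[H]) := by
        rw [τ.naturality, halfBraiding_unit]; monoidal
    _ = 𝟙 _ ⊗≫ (A ◁ H ◁ η[H] ⊗≫ (A ◁ η[A] ≫ μ[A]) ▷ (H ⊗ H)) ⊗≫ A ◁ μ[H] := by
        monoidal
    _ = _ := by
        rw [MonObj.mul_one]
        calc _ = 𝟙 _ ⊗≫ A ◁ (H ◁ η[H] ≫ μ[H]) := by monoidal
          _ = _ := by rw [MonObj.mul_one]; monoidal

theorem twisted_mul_assoc : twistedMul A τ ▷ (A ⊗ H) ≫ twistedMul A τ =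
    (α_ (A ⊗ H) (A ⊗ H) (A ⊗ H)).hom ≫ (A ⊗ H) ◁ twistedMul A τ ≫ twistedMul A τ := by
  unfold twistedMul
  rw [MonoidalCategory.tensorHom_def]
  have hA : H ◁ μ[A] ≫ (τ.β A).hom = ((α_ _ _ _).inv ≫ (τ.β A).hom ▷ A ≫ (α_ _ _ _).hom ≫
      A ◁ (τ.β A).hom ≫ (α_ _ _ _).inv) ≫ μ[A] ▷ H := by
    rw [τ.naturality, τ.monoidal]
  set s := (τ.β A).hom with hs
  have hH : μ[H] ▷ A ≫ s = _ := CentralMonoid.mul_comm (τ := τ) A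
  rw [← hs] at hH
  trans 𝟙 _ ⊗≫ A ◁ s ▷ H ▷ (A ⊗ H) ⊗≫ A ◁ A ◁ H ◁ s ▷ H ⊗≫ A ◁ A ◁ s ▷ (H ⊗ H) ⊗≫
      (μ[A] ▷ A ≫ μ[A]) ▷ (H ⊗ H ⊗ H) ⊗≫ A ◁ (μ[H] ▷ H ≫ μ[H])
  · calc _ = 𝟙 _ ⊗≫ A ◁ s ▷ H ▷ (A ⊗ H) ⊗≫ μ[A] ▷ (H ⊗ H ⊗ A ⊗ H) ⊗≫ A ◁ (μ[H] ▷ A ≫ s) ▷ H ⊗≫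
            μ[A] ▷ (H ⊗ H) ⊗≫ A ◁ μ[H] := by monoidal
      _ = 𝟙 _ ⊗≫ A ◁ s ▷ H ▷ (A ⊗ H) ⊗≫
            (μ[A] ▷ ((H ⊗ H ⊗ A) ⊗ H) ≫ A ◁ ((H ◁ s ≫ (α_ _ _ _).inv ≫ s ▷ H ≫
              (α_ _ _ _).hom) ▷ H)) ⊗≫
            ((A ⊗ A) ◁ (μ[H] ▷ H) ≫ μ[A] ▷ (H ⊗ H)) ⊗≫ A ◁ μ[H] := by rw [hH]; monoidal
      _ = _ := by
        rw [← whisker_exchange μ[A] ((H ◁ s ≫ (α_ _ _ _).inv ≫ s ▷ H ≫ (α_ _ _ _).hom) ▷ H),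
          whisker_exchange μ[A] (μ[H] ▷ H)]
        monoidal
  · calc _ = 𝟙 _ ⊗≫ A ◁ s ▷ H ▷ (A ⊗ H) ⊗≫ A ◁ A ◁ H ◁ s ▷ H ⊗≫ A ◁ A ◁ s ▷ (H ⊗ H) ⊗≫
          (A ◁ μ[A] ≫ μ[A]) ▷ (H ⊗ H ⊗ H) ⊗≫ A ◁ (H ◁ μ[H] ≫ μ[H]) := by
          rw [MonObj.mul_assoc, MonObj.mul_assoc]; monoidal
      _ = 𝟙 _ ⊗≫ A ◁ (s ▷ (H ⊗ A) ≫ (A ⊗ H) ◁ s) ▷ H ⊗≫ A ◁ A ◁ s ▷ (H ⊗ H) ⊗≫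
          A ◁ μ[A] ▷ (H ⊗ H ⊗ H) ⊗≫ (μ[A] ▷ (H ⊗ H ⊗ H) ≫ A ◁ (H ◁ μ[H])) ⊗≫ A ◁ μ[H] := by
          monoidal
      _ = 𝟙 _ ⊗≫ A ◁ ((H ⊗ A) ◁ s ≫ s ▷ (A ⊗ H)) ▷ H ⊗≫ A ◁ A ◁ s ▷ (H ⊗ H) ⊗≫
          A ◁ μ[A] ▷ (H ⊗ H ⊗ H) ⊗≫ A ◁ A ◁ H ◁ μ[H] ⊗≫ μ[A] ▷ (H ⊗ H) ⊗≫ A ◁ μ[H] := by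
          rw [← whisker_exchange s s, ← whisker_exchange μ[A] (H ◁ μ[H])]; monoidal
      _ = 𝟙 _ ⊗≫ A ◁ H ◁ A ◁ s ▷ H ⊗≫ A ◁ (((α_ _ _ _).inv ≫ s ▷ A ≫ (α_ _ _ _).hom ≫
          A ◁ s ≫ (α_ _ _ _).inv) ≫ μ[A] ▷ H) ▷ (H ⊗ H) ⊗≫ A ◁ A ◁ H ◁ μ[H] ⊗≫
          μ[A] ▷ (H ⊗ H) ⊗≫ A ◁ μ[H] := by
          monoidal
      _ = 𝟙 _ ⊗≫ A ◁ H ◁ A ◁ s ▷ H ⊗≫ A ◁ H ◁ μ[A] ▷ (H ⊗ H) ⊗≫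
          A ◁ (s ▷ (H ⊗ H) ≫ (A ⊗ H) ◁ μ[H]) ⊗≫
          μ[A] ▷ (H ⊗ H) ⊗≫ A ◁ μ[H] := by
          rw [← hA]; monoidal
      _ = _ := by
          rw [← whisker_exchange s μ[H]]; monoidal

instance : MonObj (TwistedTensor A τ) where
  one := twistedUnit A H
  mul := twistedMul A τ
  one_mul := twisted_one_mul A τ
  mul_one := twisted_mul_one A τ
  mul_assoc := twisted_mul_assoc A τ

/-- The algebra map `A ⟶ A ⊗_τ H`. -/
def twistedInl : A ⟶ TwistedTensor A τ := (ρ_ A).inv ≫ A ◁ η[H]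

/-- The algebra map `H ⟶ A ⊗_τ H`. -/
def twistedInr : H ⟶ TwistedTensor A τ := (λ_ H).inv ≫ η[A] ▷ H

instance : IsMonHom (twistedInl A τ) where
  one_hom := by
    change η[A] ≫ (ρ_ A).inv ≫ A ◁ η[H] = (λ_ _).inv ≫ (η[A] ⊗ₘ η[H])
    rw [MonoidalCategory.tensorHom_def]; monoidal
  mul_hom := by
    change μ[A] ≫ (ρ_ A).inv ≫ A ◁ η[H] =
      (((ρ_ A).inv ≫ A ◁ η[H]) ⊗ₘ ((ρ_ A).inv ≫ A ◁ η[H])) ≫ twistedMul A τ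
    unfold twistedMul
    rw [MonoidalCategory.tensorHom_def, MonoidalCategory.tensorHom_def]
    symm
    calc (((ρ_ A).inv ≫ A ◁ η[H]) ▷ A ≫ (A ⊗ H) ◁ ((ρ_ A).inv ≫ A ◁ η[H])) ≫ _ = 𝟙 _ ⊗≫ A ◁ A ◁ η[H] ⊗≫ A ◁ (η[H] ▷ A ≫ (τ.β A).hom) ▷ H ⊗≫
        (μ[A] ▷ (H ⊗ H) ≫ A ◁ μ[H]) := by
          calc _ = 𝟙 _ ⊗≫ A ◁ (η[H] ▷ (A ⊗ 𝟙_ B) ≫ H ◁ A ◁ η[H]) ⊗≫ A ◁ (τ.β A).hom ▷ H ⊗≫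
                  (μ[A] ▷ (H ⊗ H) ≫ A ◁ μ[H]) := by monoidal
            _ = _ := by rw [← whisker_exchange]; monoidal
      _ = 𝟙 _ ⊗≫ A ◁ A ◁ η[H] ⊗≫ ((A ⊗ A) ◁ (η[H] ▷ H) ≫ μ[A] ▷ (H ⊗ H)) ⊗≫ A ◁ μ[H] := by
        rw [CentralMonoid.one_comm]; monoidal
      _ = 𝟙 _ ⊗≫ ((A ⊗ A) ◁ η[H] ≫ μ[A] ▷ H) ⊗≫ A ◁ (η[H] ▷ H ≫ μ[H]) := by
        rw [whisker_exchange]; monoidal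
      _ = _ := by rw [whisker_exchange, MonObj.one_mul]; monoidal

end TwistedTensor

/-- For `δ : Id ⟶ Id ⊗ H` and `f : H ⟶ T`, the natural transformation
`(X ⊗ f) ∘ δ_X : X ⟶ X ⊗ T`. -/
def coendTrans {B : Type u} [Category.{v} B] [MonoidalCategory B] {H : B}
    (δ : 𝟭 B ⟶ tensorRight H) {T : B} (f : H ⟶ T) : 𝟭 B ⟶ tensorRight T where
  app X := δ.app X ≫ X ◁ f
  naturality X Y k := by
    have h : k ≫ δ.app Y = δ.app X ≫ k ▷ H := δ.naturality k
    change k ≫ δ.app Y ≫ Y ◁ f = (δ.app X ≫ X ◁ f) ≫ k ▷ T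
    rw [reassoc_of% h, Category.assoc, whisker_exchange]

/-- For `δ : Id ⟶ Id ⊗ H` and `f : H ⊗ P ⟶ T`, the natural transformation
`(X ⊗ f) ∘ (δ_X ⊗ P) : X ⊗ P ⟶ X ⊗ T`. -/
def strongTrans {B : Type u} [Category.{v} B] [MonoidalCategory B] {H : B}
    (δ : 𝟭 B ⟶ tensorRight H) {P T : B} (f : H ⊗ P ⟶ T) : tensorRight P ⟶ tensorRight T where
  app X := δ.app X ▷ P ≫ (α_ X H P).hom ≫ X ◁ f
  naturality X Y k := by
    have h : k ≫ δ.app Y = δ.app X ≫ k ▷ H := δ.naturality k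
    change k ▷ P ≫ δ.app Y ▷ P ≫ (α_ Y H P).hom ≫ Y ◁ f =
      (δ.app X ▷ P ≫ (α_ X H P).hom ≫ X ◁ f) ≫ k ▷ T
    rw [← comp_whiskerRight_assoc, h]
    simp [whisker_exchange]

/-- A strong coendomorphism object of (the identity functor of) a monoidal category `B`. -/
structure StrongCoend (B : Type u) [Category.{v} B] [MonoidalCategory B] where
  /-- the underlying object -/
  H : B
  /-- the universal natural transformation `X ⟶ X ⊗ H` -/
  δ : 𝟭 B ⟶ tensorRight H
  universal : ∀ T : B,
    Function.Bijective (fun f : H ⟶ T => (coendTrans δ f : 𝟭 B ⟶ tensorRight T))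
  strong : ∀ P T : B,
    Function.Bijective (fun f : H ⊗ P ⟶ T => (strongTrans δ f : tensorRight P ⟶ tensorRight T))

namespace StrongCoend

variable {B : Type u} [Category.{v} B] [MonoidalCategory B] (K : StrongCoend B)

/-- The universal coaction `δ_X : X ⟶ X ⊗ H`. -/
def ca (X : B) : X ⟶ X ⊗ K.H := K.δ.app X

theorem ca_nat {X Y : B} (f : X ⟶ Y) : f ≫ K.ca Y = K.ca X ≫ f ▷ K.H :=
  K.δ.naturality f

/-- The morphism `H ⊗ P ⟶ T` that corresponds to a natural transformation `X ⊗ P ⟶ X ⊗ T`. -/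
def desc {P T : B} (φ : ∀ X : B, X ⊗ P ⟶ X ⊗ T)
    (hφ : ∀ (X Y : B) (k : X ⟶ Y), k ▷ P ≫ φ Y = φ X ≫ k ▷ T) : K.H ⊗ P ⟶ T :=
  ((K.strong P T).2 { app := φ, naturality := hφ }).choose

theorem desc_spec {P T : B} (φ : ∀ X : B, X ⊗ P ⟶ X ⊗ T)
    (hφ : ∀ (X Y : B) (k : X ⟶ Y), k ▷ P ≫ φ Y = φ X ≫ k ▷ T) (X : B) :
    K.ca X ▷ P ≫ (α_ X K.H P).hom ≫ X ◁ K.desc φ hφ = φ X :=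
  congrArg (fun t => NatTrans.app t X)
    ((K.strong P T).2 { app := φ, naturality := hφ }).choose_spec

theorem ext_strong {P T : B} {f g : K.H ⊗ P ⟶ T}
    (h : ∀ X, K.ca X ▷ P ⊗≫ X ◁ f = K.ca X ▷ P ⊗≫ X ◁ g) : f = g := by
  apply (K.strong P T).1
  ext X
  have hX : K.ca X ▷ P ≫ (α_ X K.H P).hom ≫ X ◁ f = K.ca X ▷ P ≫ (α_ X K.H P).hom ≫ X ◁ g := by
    simpa [monoidalComp] using h X
  exact hX

/-- The morphism `H ⟶ T` that corresponds to a natural transformation `X ⟶ X ⊗ T`. -/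
def desc₁ {T : B} (φ : ∀ X : B, X ⟶ X ⊗ T)
    (hφ : ∀ (X Y : B) (k : X ⟶ Y), k ≫ φ Y = φ X ≫ k ▷ T) : K.H ⟶ T :=
  ((K.universal T).2 { app := φ, naturality := hφ }).choose

theorem desc₁_spec {T : B} (φ : ∀ X : B, X ⟶ X ⊗ T)
    (hφ : ∀ (X Y : B) (k : X ⟶ Y), k ≫ φ Y = φ X ≫ k ▷ T) (X : B) :
    K.ca X ≫ X ◁ K.desc₁ φ hφ = φ X :=
  congrArg (fun t => NatTrans.app t X)
    ((K.universal T).2 { app := φ, naturality := hφ }).choose_spec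

theorem ext_univ {T : B} {f g : K.H ⟶ T}
    (h : ∀ X, K.ca X ≫ X ◁ f = K.ca X ≫ X ◁ g) : f = g := by
  apply (K.universal T).1
  ext X
  exact h X

/-- The comultiplication of `H`: the unique map making the `δ_X` coassociative,
`(X ⊗ Δ) δ_X = (δ_X ⊗ H) δ_X` (see `ca_comul`). -/
def comul : K.H ⟶ K.H ⊗ K.H :=
  K.desc₁ (fun X => K.ca X ≫ K.ca X ▷ K.H ≫ (α_ _ _ _).hom) (fun _ _ k => by
    rw [← Category.assoc, K.ca_nat, Category.assoc, ← comp_whiskerRight_assoc, K.ca_nat]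
    simp)

/-- The counit of `H`: the unique map with `(X ⊗ ε) δ_X = id` (see `ca_counit`). -/
def counit : K.H ⟶ 𝟙_ B :=
  K.desc₁ (fun X => (ρ_ X).inv) (fun _ _ k => by simp)

theorem ca_comul (X : B) :
    K.ca X ≫ X ◁ K.comul = K.ca X ≫ K.ca X ▷ K.H ≫ (α_ _ _ _).hom := by
  unfold comul; exact K.desc₁_spec _ _ X

theorem ca_counit (X : B) : K.ca X ≫ X ◁ K.counit = (ρ_ X).inv := by
  unfold counit; exact K.desc₁_spec _ _ X

theorem counit_comul : K.comul ≫ K.counit ▷ K.H = (λ_ K.H).inv := by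
  apply K.ext_univ
  intro X
  calc K.ca X ≫ X ◁ (K.comul ≫ K.counit ▷ K.H)
      = (K.ca X ≫ X ◁ K.comul) ⊗≫ X ◁ K.counit ▷ K.H := by monoidal
    _ = K.ca X ⊗≫ (K.ca X ≫ X ◁ K.counit) ▷ K.H ⊗≫ 𝟙 _ := by rw [ca_comul]; monoidal
    _ = _ := by rw [ca_counit]; monoidal

theorem comul_counit : K.comul ≫ K.H ◁ K.counit = (ρ_ K.H).inv := by
  apply K.ext_univ
  intro X
  calc K.ca X ≫ X ◁ (K.comul ≫ K.H ◁ K.counit)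
      = (K.ca X ≫ X ◁ K.comul) ⊗≫ X ◁ K.H ◁ K.counit := by monoidal
    _ = K.ca X ⊗≫ (K.ca X ▷ K.H ≫ (X ⊗ K.H) ◁ K.counit) ⊗≫ 𝟙 _ := by rw [ca_comul]; monoidal
    _ = (K.ca X ≫ X ◁ K.counit) ⊗≫ K.ca X ⊗≫ 𝟙 _ := by rw [← whisker_exchange]; monoidal
    _ = _ := by rw [ca_counit]; monoidal

theorem comul_assoc : K.comul ≫ K.H ◁ K.comul = K.comul ≫ K.comul ▷ K.H ≫ (α_ _ _ _).hom := by
  apply K.ext_univ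
  intro X
  calc K.ca X ≫ X ◁ (K.comul ≫ K.H ◁ K.comul)
      = (K.ca X ≫ X ◁ K.comul) ⊗≫ X ◁ K.H ◁ K.comul := by monoidal
    _ = K.ca X ⊗≫ (K.ca X ▷ K.H ≫ (X ⊗ K.H) ◁ K.comul) ⊗≫ 𝟙 _ := by rw [ca_comul]; monoidal
    _ = (K.ca X ≫ X ◁ K.comul) ⊗≫ K.ca X ▷ (K.H ⊗ K.H) ⊗≫ 𝟙 _ := by
        rw [← whisker_exchange]; monoidal
    _ = K.ca X ⊗≫ ((K.ca X ≫ K.ca X ▷ K.H ≫ (α_ _ _ _).hom) ▷ K.H) ⊗≫ 𝟙 _ := by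
        rw [ca_comul]; monoidal
    _ = K.ca X ⊗≫ (K.ca X ≫ X ◁ K.comul) ▷ K.H ⊗≫ 𝟙 _ := by rw [ca_comul]
    _ = (K.ca X ≫ K.ca X ▷ K.H ≫ (α_ _ _ _).hom) ⊗≫ X ◁ K.comul ▷ K.H ⊗≫ 𝟙 _ := by monoidal
    _ = _ := by rw [← ca_comul]; monoidal

/-- The morphism `g_Y : H ⊗ Y ⟶ Y ⊗ H` with `(X ⊗ g_Y) (δ_X ⊗ Y) = δ_{X ⊗ Y}`. -/
def gg (Y : B) : K.H ⊗ Y ⟶ Y ⊗ K.H :=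
  K.desc (fun X => K.ca (X ⊗ Y) ≫ (α_ _ _ _).hom) (fun _ _ k => by
    rw [← Category.assoc, K.ca_nat]; simp)

theorem ca_gg (X Y : B) : K.ca X ▷ Y ⊗≫ X ◁ K.gg Y = K.ca (X ⊗ Y) ≫ (α_ _ _ _).hom := by
  rw [← K.desc_spec (fun X => K.ca (X ⊗ Y) ≫ (α_ _ _ _).hom) (fun _ _ k => by
    rw [← Category.assoc, K.ca_nat]; simp) X]
  unfold gg
  simp [monoidalComp]

theorem ca_gg' (X Y : B) : K.ca X ▷ Y ≫ (α_ _ _ _).hom ≫ X ◁ K.gg Y =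
    K.ca (X ⊗ Y) ≫ (α_ _ _ _).hom := by
  rw [← ca_gg]; monoidal

theorem gg_nat {Y Z : B} (f : Y ⟶ Z) : K.H ◁ f ≫ K.gg Z = K.gg Y ≫ f ▷ K.H := by
  apply K.ext_strong
  intro X
  calc K.ca X ▷ Y ⊗≫ X ◁ (K.H ◁ f ≫ K.gg Z)
      = 𝟙 _ ⊗≫ (K.ca X ▷ Y ≫ (X ⊗ K.H) ◁ f) ⊗≫ X ◁ K.gg Z := by monoidal
    _ = X ◁ f ≫ (K.ca X ▷ Z ⊗≫ X ◁ K.gg Z) := by rw [← whisker_exchange]; monoidal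
    _ = (X ◁ f ≫ K.ca _) ⊗≫ 𝟙 _ := by rw [ca_gg]; monoidal
    _ = (K.ca _ ≫ (α_ _ _ _).hom) ⊗≫ X ◁ f ▷ _ := by rw [ca_nat]; monoidal
    _ = _ := by rw [← ca_gg]; monoidal

theorem gg_tensor (Y Z : B) :
    K.gg (Y ⊗ Z) = 𝟙 _ ⊗≫ K.gg Y ▷ Z ⊗≫ Y ◁ K.gg Z ⊗≫ 𝟙 _ := by
  apply K.ext_strong
  intro X
  have h1 : K.ca (X ⊗ (Y ⊗ Z)) = (α_ _ _ _).inv ≫ K.ca ((X ⊗ Y) ⊗ Z) ≫ (α_ _ _ _).hom ▷ _ := by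
    rw [← ca_nat]; simp
  calc _ = K.ca (X ⊗ (Y ⊗ Z)) ≫ (α_ _ _ _).hom := K.ca_gg X (Y ⊗ Z)
    _ = 𝟙 _ ⊗≫ (K.ca ((X ⊗ Y) ⊗ Z) ≫ (α_ _ _ _).hom) ⊗≫ 𝟙 _ := by rw [h1]; monoidal
    _ = 𝟙 _ ⊗≫ (K.ca (X ⊗ Y) ≫ (α_ _ _ _).hom) ▷ Z ⊗≫ X ◁ Y ◁ K.gg Z ⊗≫ 𝟙 _ := by
        rw [← ca_gg]; monoidal
    _ = _ := by rw [← ca_gg]; monoidal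

variable [BraidedCategory B]

/-- The multiplication of `H` composed with an inverse braiding; see `mul`. -/
def mulAux : K.H ⊗ K.H ⟶ K.H :=
  K.desc (fun Y => (β_ K.H Y).inv ≫ K.gg Y) (fun _ _ k => by
    rw [braiding_inv_naturality_left_assoc, gg_nat, Category.assoc])

/-- The multiplication of `H`: the unique map with
`δ_{X ⊗ Y} = (X ⊗ Y ⊗ μ) (X ⊗ c_{H,Y} ⊗ H) (δ_X ⊗ δ_Y)`
(see `gg_eq`, which together with `ca_gg` says this, and `coact_tensor`). -/
def mul : K.H ⊗ K.H ⟶ K.H := (β_ _ _).hom ≫ K.mulAux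

/-- The unit of `H`: the coaction `δ_I` on the unit object. -/
def unit : 𝟙_ B ⟶ K.H := K.ca (𝟙_ B) ≫ (λ_ _).hom

theorem flip_coact (W Y : B) :
    W ◁ K.ca Y ⊗≫ (β_ W Y).hom ▷ K.H ⊗≫ 𝟙 (Y ⊗ W ⊗ K.H) =
    (β_ W Y).hom ≫ K.ca Y ▷ W ⊗≫ Y ◁ (β_ W K.H).inv := by
  have h := braiding_naturality_right W (K.ca Y)
  rw [braiding_tensor_right_hom] at h
  calc _ = W ◁ K.ca Y ⊗≫ (β_ W Y).hom ▷ K.H ⊗≫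
            Y ◁ ((β_ W K.H).hom ≫ (β_ W K.H).inv) := by
          rw [Iso.hom_inv_id]; monoidal
    _ = (W ◁ K.ca Y ≫
      (α_ W Y K.H).inv ≫ (β_ W Y).hom ▷ K.H ≫ (α_ Y W K.H).hom ≫
      Y ◁ (β_ W K.H).hom ≫ (α_ Y K.H W).inv) ⊗≫ Y ◁ (β_ W K.H).inv := by monoidal
    _ = _ := by rw [h]; monoidal

theorem ca_mulAux (Y : B) :
    K.ca Y ▷ K.H ⊗≫ Y ◁ K.mulAux = (β_ K.H Y).inv ≫ K.gg Y := by
  unfold mulAux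
  have := K.desc_spec (fun Y => (β_ K.H Y).inv ≫ K.gg Y) (fun _ _ k => by
    rw [braiding_inv_naturality_left_assoc, gg_nat, Category.assoc]) Y
  simpa [monoidalComp] using this

theorem gg_eq (Y : B) :
    K.H ◁ K.ca Y ⊗≫ (β_ K.H Y).hom ▷ K.H ⊗≫ Y ◁ K.mul = K.gg Y := by
  unfold mul
  calc _ = (K.H ◁ K.ca Y ⊗≫ (β_ K.H Y).hom ▷ K.H ⊗≫ 𝟙 (Y ⊗ K.H ⊗ K.H)) ⊗≫
            Y ◁ ((β_ K.H K.H).hom ≫ K.mulAux) := by monoidal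
    _ = (β_ K.H Y).hom ≫ K.ca Y ▷ K.H ⊗≫ Y ◁ ((β_ K.H K.H).inv ≫ (β_ K.H K.H).hom) ⊗≫
          Y ◁ K.mulAux := by
        rw [flip_coact]; monoidal
    _ = (β_ K.H Y).hom ≫ (K.ca Y ▷ K.H ⊗≫ Y ◁ K.mulAux) := by rw [Iso.inv_hom_id]; monoidal
    _ = _ := by rw [ca_mulAux, Iso.hom_inv_id_assoc]

theorem gg_eq' (Y : B) :
    K.H ◁ K.ca Y ≫ (α_ _ _ _).inv ≫ (β_ K.H Y).hom ▷ K.H ≫ (α_ _ _ _).hom ≫ Y ◁ K.mul =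
      K.gg Y := by
  rw [← gg_eq]; monoidal

/-- A morphism out of `W ⊗ H` is determined by the transformations `W ⊗ Y ⟶ Y ⊗ T` it induces. -/
theorem ext_flip {W T : B} {f g : W ⊗ K.H ⟶ T}
    (h : ∀ Y, W ◁ K.ca Y ⊗≫ (β_ W Y).hom ▷ K.H ⊗≫ Y ◁ f =
      W ◁ K.ca Y ⊗≫ (β_ W Y).hom ▷ K.H ⊗≫ Y ◁ g) : f = g := by
  have key : ∀ (f : W ⊗ K.H ⟶ T) (Y : B),
      W ◁ K.ca Y ⊗≫ (β_ W Y).hom ▷ K.H ⊗≫ Y ◁ f =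
      (β_ W Y).hom ≫ (K.ca Y ▷ W ⊗≫ Y ◁ ((β_ W K.H).inv ≫ f)) := by
    intro f Y
    calc _ = (W ◁ K.ca Y ⊗≫ (β_ W Y).hom ▷ K.H ⊗≫ 𝟙 (Y ⊗ W ⊗ K.H)) ≫ Y ◁ f := by monoidal
      _ = _ := by rw [flip_coact]; monoidal
  rw [← cancel_epi (β_ W K.H).inv]
  apply K.ext_strong
  intro Y
  have hY := h Y
  rw [key, key, cancel_epi] at hY
  exact hY

/-- A morphism out of `W ⊗ (H ⊗ P)` is determined by the transformations
`W ⊗ (Y ⊗ P) ⟶ Y ⊗ T` it induces. -/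
theorem ext_flip_two {W P T : B} {f g : W ⊗ K.H ⊗ P ⟶ T}
    (h : ∀ Y, W ◁ K.ca Y ▷ P ⊗≫ (β_ W Y).hom ▷ (K.H ⊗ P) ⊗≫ Y ◁ f =
      W ◁ K.ca Y ▷ P ⊗≫ (β_ W Y).hom ▷ (K.H ⊗ P) ⊗≫ Y ◁ g) : f = g := by
  have key : ∀ (f : W ⊗ K.H ⊗ P ⟶ T) (Y : B),
      W ◁ K.ca Y ▷ P ⊗≫ (β_ W Y).hom ▷ (K.H ⊗ P) ⊗≫ Y ◁ f =
      𝟙 _ ⊗≫ (β_ W Y).hom ▷ P ⊗≫ (K.ca Y ▷ (W ⊗ P) ⊗≫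
        Y ◁ ((α_ _ _ _).inv ≫ (β_ W K.H).inv ▷ P ≫ (α_ _ _ _).hom ≫ f)) := by
    intro f Y
    calc _ = 𝟙 _ ⊗≫ (W ◁ K.ca Y ⊗≫ (β_ W Y).hom ▷ K.H ⊗≫ 𝟙 (Y ⊗ W ⊗ K.H)) ▷ P ⊗≫
            Y ◁ f := by monoidal
      _ = _ := by rw [flip_coact]; monoidal
  rw [← cancel_epi ((α_ _ _ _).inv ≫ (β_ W K.H).inv ▷ P ≫ (α_ _ _ _).hom)]
  apply K.ext_strong
  intro Y
  have h' := h Y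
  rw [key, key] at h'
  simpa [monoidalComp, cancel_epi] using h'

theorem unit_gg (Y : B) : K.unit ▷ Y ≫ K.gg Y = (λ_ Y).hom ≫ K.ca Y := by
  unfold unit
  calc _ = (K.ca (𝟙_ B) ▷ Y ≫ (α_ _ _ _).hom ≫ 𝟙_ B ◁ K.gg Y) ⊗≫ 𝟙 _ := by monoidal
    _ = K.ca (𝟙_ B ⊗ Y) ≫ (λ_ Y).hom ▷ K.H := by rw [ca_gg']; monoidal
    _ = _ := by rw [ca_nat]

theorem gg_unit : K.gg (𝟙_ B) = (ρ_ _).hom ≫ (λ_ _).inv := by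
  apply K.ext_strong
  intro X
  calc _ = K.ca (X ⊗ 𝟙_ B) ≫ (α_ _ _ _).hom := K.ca_gg X _
    _ = (K.ca (X ⊗ 𝟙_ B) ≫ (ρ_ X).hom ▷ K.H) ⊗≫ 𝟙 _ := by monoidal
    _ = _ := by rw [← ca_nat]; monoidal

theorem coact_tensor (X Y : B) : K.ca (X ⊗ Y) =
    K.ca X ▷ Y ⊗≫ (X ⊗ K.H) ◁ K.ca Y ⊗≫ X ◁ (β_ K.H Y).hom ▷ K.H ⊗≫ (X ⊗ Y) ◁ K.mul := by
  have h := K.ca_gg X Y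
  rw [← gg_eq] at h
  rw [← cancel_mono (α_ X Y K.H).hom, ← h]
  monoidal

theorem unit_mul : K.unit ▷ K.H ≫ K.mul = (λ_ K.H).hom := by
  rw [← cancel_epi (λ_ K.H).inv, Iso.inv_hom_id]
  apply K.ext_univ
  intro Y
  have h := K.unit_gg Y
  rw [← gg_eq, ← Iso.inv_comp_eq] at h
  have h1 := braiding_naturality_left K.unit Y
  rw [braiding_tensorUnit_left] at h1
  calc _ = 𝟙 _ ⊗≫ 𝟙_ B ◁ K.ca Y ⊗≫ (((λ_ Y).hom ≫ (ρ_ Y).inv) ≫ Y ◁ K.unit) ▷ K.H ⊗≫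
        Y ◁ K.mul := by monoidal
    _ = 𝟙 _ ⊗≫ (𝟙_ B ◁ K.ca Y ≫ K.unit ▷ (Y ⊗ K.H)) ⊗≫ (β_ K.H Y).hom ▷ K.H ⊗≫
        Y ◁ K.mul := by rw [← h1]; monoidal
    _ = (λ_ Y).inv ≫ K.unit ▷ Y ≫
      (K.H ◁ K.ca Y ⊗≫ (β_ K.H Y).hom ▷ K.H ⊗≫ Y ◁ K.mul) := by
        rw [whisker_exchange]; monoidal
    _ = _ := by rw [h]; simp

theorem mul_unit : K.H ◁ K.unit ≫ K.mul = (ρ_ K.H).hom := by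
  have h := K.gg_eq' (𝟙_ B)
  rw [gg_unit, braiding_tensorUnit_right] at h
  unfold unit
  calc _ = (K.H ◁ K.ca (𝟙_ B) ≫ (α_ _ _ _).inv ≫ ((ρ_ K.H).hom ≫ (λ_ K.H).inv) ▷ K.H ≫
        (α_ _ _ _).hom ≫ 𝟙_ B ◁ K.mul) ⊗≫ 𝟙 _ := by monoidal
    _ = _ := by rw [h]; monoidal

theorem mul_gg (Z : B) : K.mul ▷ Z ≫ K.gg Z =
    𝟙 _ ⊗≫ K.H ◁ K.gg Z ⊗≫ (β_ K.H Z).hom ▷ K.H ⊗≫ Z ◁ K.mul := by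
  rw [← cancel_epi (α_ K.H K.H Z).inv]
  apply K.ext_flip_two
  intro Y
  calc _ = 𝟙 _ ⊗≫ (K.H ◁ K.ca Y ⊗≫ (β_ K.H Y).hom ▷ K.H ⊗≫ Y ◁ K.mul) ▷ Z ⊗≫ Y ◁ K.gg Z := by
          monoidal
    _ = K.gg (Y ⊗ Z) ⊗≫ 𝟙 (Y ⊗ Z ⊗ K.H) := by rw [gg_eq, gg_tensor]; monoidal
    _ = 𝟙 _ ⊗≫ K.H ◁ (K.ca (Y ⊗ Z) ≫ (α_ _ _ _).hom) ⊗≫ ((β_ K.H Y).hom ▷ Z) ▷ K.H ⊗≫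
           (Y ◁ (β_ K.H Z).hom) ▷ K.H ⊗≫ (Y ⊗ Z) ◁ K.mul ⊗≫ 𝟙 (Y ⊗ Z ⊗ K.H) := by
          rw [← gg_eq, braiding_tensor_right_hom]; monoidal
    _ = 𝟙 _ ⊗≫ K.H ◁ K.ca Y ▷ Z ⊗≫ (K.H ◁ Y ◁ K.gg Z ⊗≫ ((β_ K.H Y).hom ▷ (Z ⊗ K.H))) ⊗≫
           (Y ◁ (β_ K.H Z).hom) ▷ K.H ⊗≫ (Y ⊗ Z) ◁ K.mul ⊗≫ 𝟙 (Y ⊗ Z ⊗ K.H) := by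
          rw [← ca_gg]; monoidal
    _ = 𝟙 _ ⊗≫ K.H ◁ K.ca Y ▷ Z ⊗≫ ((K.H ⊗ Y) ◁ K.gg Z ≫ ((β_ K.H Y).hom ▷ (Z ⊗ K.H))) ⊗≫
           (Y ◁ (β_ K.H Z).hom) ▷ K.H ⊗≫ (Y ⊗ Z) ◁ K.mul ⊗≫ 𝟙 (Y ⊗ Z ⊗ K.H) := by
          monoidal
    _ = _ := by rw [whisker_exchange]; monoidal

theorem mul_assoc' : K.mul ▷ K.H ≫ K.mul = (α_ _ _ _).hom ≫ K.H ◁ K.mul ≫ K.mul := by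
  apply K.ext_flip
  intro Z
  calc _ = (K.H ⊗ K.H) ◁ K.ca Z ⊗≫ ((β_ (K.H ⊗ K.H) Z).hom ≫ Z ◁ K.mul) ▷ K.H ⊗≫ Z ◁ K.mul := by
        monoidal
    _ = ((K.H ⊗ K.H) ◁ K.ca Z ≫ K.mul ▷ (Z ⊗ K.H)) ⊗≫ (β_ K.H Z).hom ▷ K.H ⊗≫ Z ◁ K.mul := by
        rw [← braiding_naturality_left]; monoidal
    _ = K.mul ▷ Z ≫ (K.H ◁ K.ca Z ⊗≫ (β_ K.H Z).hom ▷ K.H ⊗≫ Z ◁ K.mul) := by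
        rw [whisker_exchange]; monoidal
    _ = 𝟙 _ ⊗≫ K.H ◁ (K.H ◁ K.ca Z ⊗≫ (β_ K.H Z).hom ▷ K.H ⊗≫ Z ◁ K.mul) ⊗≫
          (β_ K.H Z).hom ▷ K.H ⊗≫ Z ◁ K.mul := by
        rw [gg_eq, mul_gg]
    _ = 𝟙 _ ⊗≫ K.H ◁ K.H ◁ K.ca Z ⊗≫ K.H ◁ (β_ K.H Z).hom ▷ K.H ⊗≫ ((K.H ⊗ Z) ◁ K.mul ≫
          (β_ K.H Z).hom ▷ K.H) ⊗≫ Z ◁ K.mul := by monoidal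
    _ = _ := by rw [whisker_exchange, braiding_tensor_left_hom]; monoidal

theorem sig_aux (Y X X' : B) (k : X ⟶ X') :
    k ▷ Y ≫ (β_ X' Y).hom ≫ Y ◁ K.ca X' ≫ (α_ _ _ _).inv ≫ (β_ Y X').hom ▷ K.H ≫
      (α_ _ _ _).hom =
    ((β_ X Y).hom ≫ Y ◁ K.ca X ≫ (α_ _ _ _).inv ≫ (β_ Y X).hom ▷ K.H ≫
      (α_ _ _ _).hom) ≫ k ▷ (Y ⊗ K.H) := by
  rw [braiding_naturality_left_assoc, ← MonoidalCategory.whiskerLeft_comp_assoc, ca_nat,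
    MonoidalCategory.whiskerLeft_comp_assoc]
  simp only [Category.assoc]
  rw [associator_inv_naturality_middle_assoc, ← comp_whiskerRight_assoc,
    braiding_naturality_right, comp_whiskerRight_assoc, associator_naturality_left]

/-- The half-braiding `σ_Y : H ⊗ Y ⟶ Y ⊗ H` of `H`, the unique map with
`(X ⊗ σ_Y) (δ_X ⊗ Y) = (c_{Y,X} ⊗ H) (Y ⊗ δ_X) c_{X,Y}` (see `ca_sig`). -/
def sig (Y : B) : K.H ⊗ Y ⟶ Y ⊗ K.H :=
  K.desc (fun X => (β_ X Y).hom ≫ Y ◁ K.ca X ≫ (α_ _ _ _).inv ≫ (β_ Y X).hom ▷ K.H ≫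
      (α_ _ _ _).hom) (K.sig_aux Y)

theorem ca_sig (X Y : B) : K.ca X ▷ Y ⊗≫ X ◁ K.sig Y =
    (β_ X Y).hom ≫ Y ◁ K.ca X ⊗≫ (β_ Y X).hom ▷ K.H ⊗≫ 𝟙 (X ⊗ Y ⊗ K.H) := by
  have h := K.desc_spec (fun X => (β_ X Y).hom ≫ Y ◁ K.ca X ≫ (α_ _ _ _).inv ≫
      (β_ Y X).hom ▷ K.H ≫ (α_ _ _ _).hom) (K.sig_aux Y) X
  unfold sig
  calc _ = _ := by monoidal
    _ = _ := h
    _ = _ := by monoidal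

theorem ca_sig' (X Y : B) : K.ca X ▷ Y ≫ (α_ _ _ _).hom ≫ X ◁ K.sig Y =
    (β_ X Y).hom ≫ Y ◁ K.ca X ⊗≫ (β_ Y X).hom ▷ K.H ⊗≫ 𝟙 (X ⊗ Y ⊗ K.H) := by
  rw [← ca_sig]; monoidal

theorem sig_nat {Y Z : B} (f : Y ⟶ Z) : K.H ◁ f ≫ K.sig Z = K.sig Y ≫ f ▷ K.H := by
  apply K.ext_strong
  intro X
  calc K.ca X ▷ Y ⊗≫ X ◁ (K.H ◁ f ≫ K.sig Z)
      = 𝟙 _ ⊗≫ (K.ca X ▷ Y ≫ (X ⊗ K.H) ◁ f) ⊗≫ X ◁ K.sig Z := by monoidal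
    _ = X ◁ f ≫ (K.ca X ▷ Z ⊗≫ X ◁ K.sig Z) := by rw [← whisker_exchange]; monoidal
    _ = (β_ X Y).hom ≫ (f ▷ X ≫ Z ◁ K.ca X) ⊗≫ (β_ Z X).hom ▷ K.H ⊗≫ 𝟙 (X ⊗ Z ⊗ K.H) := by
        rw [ca_sig, braiding_naturality_right_assoc]; monoidal
    _ = (β_ X Y).hom ≫ Y ◁ K.ca X ⊗≫ (f ▷ X ≫ (β_ Z X).hom) ▷ K.H ⊗≫ 𝟙 (X ⊗ Z ⊗ K.H) := by
        rw [← whisker_exchange]; monoidal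
    _ = ((β_ X Y).hom ≫ Y ◁ K.ca X ⊗≫ (β_ Y X).hom ▷ K.H ⊗≫ 𝟙 (X ⊗ Y ⊗ K.H)) ≫ X ◁ f ▷ K.H := by
        rw [braiding_naturality_left]; monoidal
    _ = _ := by rw [← ca_sig]; monoidal

theorem sig_tensor (Y Z : B) :
    K.sig (Y ⊗ Z) = 𝟙 _ ⊗≫ K.sig Y ▷ Z ⊗≫ Y ◁ K.sig Z ⊗≫ 𝟙 _ := by
  apply K.ext_strong
  intro X
  rw [ca_sig]
  calc _ = 𝟙 _ ⊗≫ (β_ X Y).hom ▷ Z ⊗≫ Y ◁ ((β_ X Z).hom ≫ Z ◁ K.ca X ⊗≫ (β_ Z X).hom ▷ K.H ⊗≫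
            𝟙 (X ⊗ Z ⊗ K.H)) ⊗≫ (β_ Y X).hom ▷ (Z ⊗ K.H) ⊗≫ 𝟙 _ := by
        rw [braiding_tensor_left_hom, braiding_tensor_right_hom]; monoidal
    _ = 𝟙 _ ⊗≫ (β_ X Y).hom ▷ Z ⊗≫ Y ◁ K.ca X ▷ Z ⊗≫ ((Y ⊗ X) ◁ K.sig Z ≫
            (β_ Y X).hom ▷ (Z ⊗ K.H)) ⊗≫ 𝟙 _ := by
        rw [← ca_sig]; monoidal
    _ = 𝟙 _ ⊗≫ ((β_ X Y).hom ≫ Y ◁ K.ca X ⊗≫ (β_ Y X).hom ▷ K.H ⊗≫ 𝟙 (X ⊗ Y ⊗ K.H)) ▷ Z ⊗≫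
            X ◁ Y ◁ K.sig Z ⊗≫ 𝟙 _ := by
        rw [whisker_exchange]; monoidal
    _ = _ := by rw [← ca_sig]; monoidal

theorem tau_aux (Y X X' : B) (k : X ⟶ X') :
    k ▷ Y ≫ (β_ Y X').inv ≫ (β_ X' Y).inv ≫ K.ca X' ▷ Y ≫ (α_ _ _ _).hom =
    ((β_ Y X).inv ≫ (β_ X Y).inv ≫ K.ca X ▷ Y ≫ (α_ _ _ _).hom) ≫ k ▷ (K.H ⊗ Y) := by
  rw [braiding_inv_naturality_left_assoc, braiding_inv_naturality_right_assoc,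
    ← comp_whiskerRight_assoc, ca_nat]
  simp

/-- The inverse of the half-braiding. -/
def tau (Y : B) : Y ⊗ K.H ⟶ K.H ⊗ Y :=
  (β_ Y K.H).hom ≫ K.desc (fun X => (β_ Y X).inv ≫ (β_ X Y).inv ≫ K.ca X ▷ Y ≫ (α_ _ _ _).hom)
    (K.tau_aux Y)

theorem ca_tau (X Y : B) : Y ◁ K.ca X ⊗≫ (β_ Y X).hom ▷ K.H ⊗≫ X ◁ K.tau Y =
    (β_ X Y).inv ≫ K.ca X ▷ Y ≫ (α_ _ _ _).hom := by
  have h := K.desc_spec (fun X => (β_ Y X).inv ≫ (β_ X Y).inv ≫ K.ca X ▷ Y ≫ (α_ _ _ _).hom)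
    (K.tau_aux Y) X
  unfold tau
  generalize K.desc (fun X => (β_ Y X).inv ≫ (β_ X Y).inv ≫ K.ca X ▷ Y ≫ (α_ _ _ _).hom)
    (K.tau_aux Y) = t at *
  calc _ = (Y ◁ K.ca X ⊗≫ (β_ Y X).hom ▷ K.H ⊗≫ 𝟙 (X ⊗ Y ⊗ K.H)) ≫ X ◁ (β_ Y K.H).hom ≫ X ◁ t := by
        monoidal
    _ = (β_ Y X).hom ≫ K.ca X ▷ Y ⊗≫ X ◁ ((β_ Y K.H).inv ≫ (β_ Y K.H).hom) ≫ X ◁ t := by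
        rw [flip_coact]; monoidal
    _ = (β_ Y X).hom ≫ (K.ca X ▷ Y ≫ (α_ _ _ _).hom ≫ X ◁ t) := by
        rw [Iso.inv_hom_id]; monoidal
    _ = _ := by rw [h, Iso.hom_inv_id_assoc]

theorem sig_tau (Y : B) : K.sig Y ≫ K.tau Y = 𝟙 _ := by
  apply K.ext_strong
  intro X
  calc _ = (K.ca X ▷ Y ⊗≫ X ◁ K.sig Y) ≫ X ◁ K.tau Y := by monoidal
    _ = (β_ X Y).hom ≫ (Y ◁ K.ca X ⊗≫ (β_ Y X).hom ▷ K.H ⊗≫ X ◁ K.tau Y) := by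
        rw [ca_sig]; monoidal
    _ = _ := by rw [ca_tau, Iso.hom_inv_id_assoc]; monoidal

theorem tau_sig (Y : B) : K.tau Y ≫ K.sig Y = 𝟙 _ := by
  apply K.ext_flip
  intro X
  calc _ = (Y ◁ K.ca X ⊗≫ (β_ Y X).hom ▷ K.H ⊗≫ X ◁ K.tau Y) ≫ X ◁ K.sig Y := by monoidal
    _ = (β_ X Y).inv ≫ (K.ca X ▷ Y ⊗≫ X ◁ K.sig Y) := by rw [ca_tau]; monoidal
    _ = _ := by rw [ca_sig, Iso.inv_hom_id_assoc]; monoidal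

theorem unit_sig (Y : B) : K.unit ▷ Y ≫ K.sig Y = (λ_ Y).hom ≫ (ρ_ Y).inv ≫ Y ◁ K.unit := by
  unfold unit
  calc _ = (K.ca (𝟙_ B) ▷ Y ≫ (α_ _ _ _).hom ≫ 𝟙_ B ◁ K.sig Y) ⊗≫ 𝟙 _ := by monoidal
    _ = _ := by rw [ca_sig', braiding_tensorUnit_left, braiding_tensorUnit_right]; monoidal

theorem gg_sig (Y Z : B) : 𝟙 (K.H ⊗ Z ⊗ Y) ⊗≫ K.gg Z ▷ Y ⊗≫ Z ◁ K.sig Y =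
    K.H ◁ (β_ Z Y).hom ⊗≫ K.sig Y ▷ Z ⊗≫ Y ◁ K.gg Z ⊗≫ (β_ Y Z).hom ▷ K.H ⊗≫
      𝟙 (Z ⊗ Y ⊗ K.H) := by
  apply K.ext_strong
  intro X
  calc _ = 𝟙 _ ⊗≫ (K.ca X ▷ Z ⊗≫ X ◁ K.gg Z) ▷ Y ⊗≫ (X ⊗ Z) ◁ K.sig Y ⊗≫ 𝟙 (X ⊗ Z ⊗ Y ⊗ K.H) := by
        monoidal
    _ = 𝟙 _ ⊗≫ (K.ca (X ⊗ Z) ▷ Y ≫ (α_ _ _ _).hom ≫ (X ⊗ Z) ◁ K.sig Y) ⊗≫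
          𝟙 (X ⊗ Z ⊗ Y ⊗ K.H) := by
        rw [ca_gg]; monoidal
    _ = 𝟙 _ ⊗≫ X ◁ (β_ Z Y).hom ⊗≫ (β_ X Y).hom ▷ Z ⊗≫ Y ◁ (K.ca (X ⊗ Z) ≫ (α_ _ _ _).hom) ⊗≫
          (β_ Y X).hom ▷ (Z ⊗ K.H) ⊗≫ X ◁ (β_ Y Z).hom ▷ K.H ⊗≫ 𝟙 (X ⊗ Z ⊗ Y ⊗ K.H) := by
        rw [ca_sig', braiding_tensor_left_hom, braiding_tensor_right_hom]; monoidal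
    _ = 𝟙 _ ⊗≫ X ◁ (β_ Z Y).hom ⊗≫ (β_ X Y).hom ▷ Z ⊗≫ Y ◁ K.ca X ▷ Z ⊗≫
          ((Y ⊗ X) ◁ K.gg Z ≫ (β_ Y X).hom ▷ (Z ⊗ K.H)) ⊗≫ X ◁ (β_ Y Z).hom ▷ K.H ⊗≫
          𝟙 (X ⊗ Z ⊗ Y ⊗ K.H) := by
        rw [← ca_gg]; monoidal
    _ = 𝟙 _ ⊗≫ X ◁ (β_ Z Y).hom ⊗≫ ((β_ X Y).hom ≫ Y ◁ K.ca X ⊗≫ (β_ Y X).hom ▷ K.H ⊗≫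
          𝟙 (X ⊗ Y ⊗ K.H)) ▷ Z ⊗≫ X ◁ Y ◁ K.gg Z ⊗≫ X ◁ (β_ Y Z).hom ▷ K.H ⊗≫
          𝟙 (X ⊗ Z ⊗ Y ⊗ K.H) := by
        rw [whisker_exchange]; monoidal
    _ = 𝟙 _ ⊗≫ (X ◁ (β_ Z Y).hom ≫ K.ca X ▷ (Y ⊗ Z)) ⊗≫ X ◁ K.sig Y ▷ Z ⊗≫ X ◁ Y ◁ K.gg Z ⊗≫
          X ◁ (β_ Y Z).hom ▷ K.H ⊗≫ 𝟙 (X ⊗ Z ⊗ Y ⊗ K.H) := by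
        rw [← ca_sig]; monoidal
    _ = _ := by rw [whisker_exchange]; monoidal

theorem mul_sig (Y : B) : K.mul ▷ Y ≫ K.sig Y =
    (α_ _ _ _).hom ≫ K.H ◁ K.sig Y ≫ (α_ _ _ _).inv ≫ K.sig Y ▷ K.H ≫ (α_ _ _ _).hom ≫
      Y ◁ K.mul := by
  rw [← cancel_epi (α_ K.H K.H Y).inv]
  apply K.ext_flip_two
  intro Z
  have h := braiding_naturality_left (K.sig Y) Z
  rw [braiding_tensor_left_hom, braiding_tensor_left_hom] at h
  calc _ = 𝟙 _ ⊗≫ (K.H ◁ K.ca Z ⊗≫ (β_ K.H Z).hom ▷ K.H ⊗≫ Z ◁ K.mul) ▷ Y ⊗≫ Z ◁ K.sig Y := by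
        monoidal
    _ = 𝟙 _ ⊗≫ K.gg Z ▷ Y ⊗≫ Z ◁ K.sig Y := by rw [gg_eq]
    _ = 𝟙 _ ⊗≫ K.H ◁ (β_ Z Y).hom ⊗≫ K.sig Y ▷ Z ⊗≫
          Y ◁ (K.H ◁ K.ca Z ⊗≫ (β_ K.H Z).hom ▷ K.H ⊗≫ Z ◁ K.mul) ⊗≫
          (β_ Y Z).hom ▷ K.H ⊗≫ 𝟙 (Z ⊗ Y ⊗ K.H) := by
        rw [gg_sig, gg_eq]; monoidal
    _ = 𝟙 _ ⊗≫ K.H ◁ (β_ Z Y).hom ⊗≫ (K.sig Y ▷ Z ≫ (Y ⊗ K.H) ◁ K.ca Z) ⊗≫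
          Y ◁ (β_ K.H Z).hom ▷ K.H ⊗≫ ((Y ⊗ Z) ◁ K.mul ≫ (β_ Y Z).hom ▷ K.H) ⊗≫
          𝟙 (Z ⊗ Y ⊗ K.H) := by monoidal
    _ = 𝟙 _ ⊗≫ K.H ◁ (β_ Z Y).hom ⊗≫ K.H ◁ Y ◁ K.ca Z ⊗≫
          (K.sig Y ▷ Z ≫ (α_ _ _ _).hom ≫ Y ◁ (β_ K.H Z).hom ≫ (α_ _ _ _).inv ≫
            (β_ Y Z).hom ▷ K.H ≫ (α_ _ _ _).hom) ▷ K.H ⊗≫ Z ◁ Y ◁ K.mul := by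
        rw [← whisker_exchange, whisker_exchange _ K.mul]; monoidal
    _ = 𝟙 _ ⊗≫ K.H ◁ ((β_ Z Y).hom ≫ Y ◁ K.ca Z ⊗≫ (β_ Y Z).hom ▷ K.H ⊗≫ 𝟙 (Z ⊗ Y ⊗ K.H)) ⊗≫
          (β_ K.H Z).hom ▷ (Y ⊗ K.H) ⊗≫ Z ◁ K.sig Y ▷ K.H ⊗≫ Z ◁ Y ◁ K.mul := by
        rw [h]; monoidal
    _ = 𝟙 _ ⊗≫ K.H ◁ K.ca Z ▷ Y ⊗≫ ((K.H ⊗ Z) ◁ K.sig Y ≫ (β_ K.H Z).hom ▷ (Y ⊗ K.H)) ⊗≫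
          Z ◁ K.sig Y ▷ K.H ⊗≫ Z ◁ Y ◁ K.mul := by
        rw [← ca_sig]; monoidal
    _ = _ := by rw [whisker_exchange]; monoidal

theorem gg_comul (Y : B) : K.gg Y ≫ Y ◁ K.comul =
    K.comul ▷ Y ⊗≫ K.H ◁ K.gg Y ⊗≫ K.gg Y ▷ K.H ⊗≫ 𝟙 (Y ⊗ K.H ⊗ K.H) := by
  apply K.ext_strong
  intro X
  calc _ = (K.ca X ▷ Y ⊗≫ X ◁ K.gg Y) ≫ X ◁ Y ◁ K.comul := by monoidal
    _ = (K.ca (X ⊗ Y) ≫ (X ⊗ Y) ◁ K.comul) ⊗≫ 𝟙 (X ⊗ Y ⊗ K.H ⊗ K.H) := by rw [ca_gg]; monoidal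
    _ = (K.ca (X ⊗ Y) ≫ (α_ _ _ _).hom) ⊗≫ (K.ca (X ⊗ Y) ≫ (α_ _ _ _).hom) ▷ K.H ⊗≫
          𝟙 (X ⊗ Y ⊗ K.H ⊗ K.H) := by rw [ca_comul]; monoidal
    _ = K.ca X ▷ Y ⊗≫ (X ◁ K.gg Y ≫ K.ca X ▷ (Y ⊗ K.H)) ⊗≫ X ◁ K.gg Y ▷ K.H ⊗≫
          𝟙 (X ⊗ Y ⊗ K.H ⊗ K.H) := by rw [← ca_gg]; monoidal
    _ = (K.ca X ≫ K.ca X ▷ K.H ≫ (α_ _ _ _).hom) ▷ Y ⊗≫ X ◁ K.H ◁ K.gg Y ⊗≫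
          X ◁ K.gg Y ▷ K.H ⊗≫ 𝟙 (X ⊗ Y ⊗ K.H ⊗ K.H) := by rw [whisker_exchange]; monoidal
    _ = _ := by rw [← ca_comul]; monoidal

theorem gg_counit (Y : B) : K.gg Y ≫ Y ◁ K.counit = K.counit ▷ Y ⊗≫ 𝟙 _ := by
  apply K.ext_strong
  intro X
  calc _ = (K.ca X ▷ Y ⊗≫ X ◁ K.gg Y) ≫ X ◁ Y ◁ K.counit := by monoidal
    _ = (K.ca (X ⊗ Y) ≫ (X ⊗ Y) ◁ K.counit) ⊗≫ 𝟙 (X ⊗ Y ⊗ 𝟙_ B) := by rw [ca_gg]; monoidal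
    _ = (K.ca X ≫ X ◁ K.counit) ▷ Y ⊗≫ 𝟙 (X ⊗ Y ⊗ 𝟙_ B) := by rw [ca_counit, ca_counit]; monoidal
    _ = _ := by monoidal

theorem mul_counit' : K.mul ≫ K.counit = K.counit ▷ K.H ≫ (λ_ _).hom ≫ K.counit := by
  apply K.ext_flip
  intro Y
  calc _ = (K.H ◁ K.ca Y ⊗≫ (β_ K.H Y).hom ▷ K.H ⊗≫ Y ◁ K.mul) ≫ Y ◁ K.counit := by monoidal
    _ = K.counit ▷ Y ⊗≫ 𝟙 _ := by rw [gg_eq, gg_counit]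
    _ = K.counit ▷ Y ⊗≫ (K.ca Y ≫ Y ◁ K.counit) ⊗≫ 𝟙 (Y ⊗ 𝟙_ B) := by rw [ca_counit]; monoidal
    _ = 𝟙 _ ⊗≫ (K.counit ▷ Y ≫ 𝟙_ B ◁ K.ca Y) ⊗≫ Y ◁ K.counit ⊗≫ 𝟙 (Y ⊗ 𝟙_ B) := by
      monoidal
    _ = K.H ◁ K.ca Y ⊗≫ (K.counit ▷ Y ≫ (λ_ Y).hom ≫ (ρ_ Y).inv) ▷ K.H ⊗≫ Y ◁ K.counit ⊗≫
         𝟙 (Y ⊗ 𝟙_ B) := by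
      rw [← whisker_exchange]; monoidal
    _ = _ := by
      rw [← braiding_tensorUnit_left, braiding_naturality_left]; monoidal

theorem mul_comul' : K.mul ≫ K.comul = K.comul ▷ K.H ≫ (K.H ⊗ K.H) ◁ K.comul ⊗≫
    K.H ◁ (β_ K.H K.H).hom ▷ K.H ⊗≫ K.mul ▷ (K.H ⊗ K.H) ≫ K.H ◁ K.mul := by
  apply K.ext_flip
  intro Y
  have h := braiding_naturality_right K.H (K.ca Y)
  rw [braiding_tensor_right_hom] at h
  have h2 := braiding_naturality_left K.comul Y
  rw [braiding_tensor_left_hom] at h2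
  calc _ = (K.H ◁ K.ca Y ⊗≫ (β_ K.H Y).hom ▷ K.H ⊗≫ Y ◁ K.mul) ≫ Y ◁ K.comul := by monoidal
    _ = K.comul ▷ Y ⊗≫ K.H ◁ (K.H ◁ K.ca Y ⊗≫ (β_ K.H Y).hom ▷ K.H ⊗≫ Y ◁ K.mul) ⊗≫
          (K.H ◁ K.ca Y ⊗≫ (β_ K.H Y).hom ▷ K.H ⊗≫ Y ◁ K.mul) ▷ K.H ⊗≫
          𝟙 (Y ⊗ K.H ⊗ K.H) := by
        rw [gg_eq, gg_comul]
    _ = K.comul ▷ Y ⊗≫ K.H ◁ K.H ◁ K.ca Y ⊗≫ K.H ◁ (β_ K.H Y).hom ▷ K.H ⊗≫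
          ((K.H ⊗ Y) ◁ K.mul ≫ ((K.H ◁ K.ca Y) ≫ (α_ _ _ _).inv ≫ (β_ K.H Y).hom ▷ K.H) ▷ K.H) ⊗≫
          (Y ◁ K.mul) ▷ K.H ⊗≫ 𝟙 (Y ⊗ K.H ⊗ K.H) := by monoidal
    _ = K.comul ▷ Y ⊗≫ K.H ◁ K.H ◁ K.ca Y ⊗≫
          K.H ◁ ((β_ K.H Y).hom ≫ K.ca Y ▷ K.H) ▷ K.H ⊗≫
          (β_ K.H Y).hom ▷ (K.H ⊗ K.H ⊗ K.H) ⊗≫ Y ◁ (K.H ⊗ K.H) ◁ K.mul ⊗≫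
          (Y ◁ K.mul) ▷ K.H ⊗≫ 𝟙 (Y ⊗ K.H ⊗ K.H) := by
        rw [whisker_exchange]; monoidal
    _ = K.comul ▷ Y ⊗≫ K.H ◁ K.H ◁ (K.ca Y ≫ K.ca Y ▷ K.H ≫ (α_ _ _ _).hom) ⊗≫
          K.H ◁ (β_ K.H Y).hom ▷ (K.H ⊗ K.H) ⊗≫ K.H ◁ Y ◁ (β_ K.H K.H).hom ▷ K.H ⊗≫
          (β_ K.H Y).hom ▷ (K.H ⊗ K.H ⊗ K.H) ⊗≫ Y ◁ (K.H ⊗ K.H) ◁ K.mul ⊗≫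
          (Y ◁ K.mul) ▷ K.H ⊗≫ 𝟙 (Y ⊗ K.H ⊗ K.H) := by
        rw [← h]; monoidal
    _ = K.comul ▷ Y ⊗≫ K.H ◁ K.H ◁ (K.ca Y ≫ Y ◁ K.comul) ⊗≫
          K.H ◁ (β_ K.H Y).hom ▷ (K.H ⊗ K.H) ⊗≫ ((K.H ⊗ Y) ◁ ((β_ K.H K.H).hom ▷ K.H) ≫
          (β_ K.H Y).hom ▷ ((K.H ⊗ K.H) ⊗ K.H)) ⊗≫ Y ◁ (K.H ⊗ K.H) ◁ K.mul ⊗≫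
          (Y ◁ K.mul) ▷ K.H ⊗≫ 𝟙 (Y ⊗ K.H ⊗ K.H) := by
        rw [ca_comul]; monoidal
    _ = K.comul ▷ Y ⊗≫ K.H ◁ K.H ◁ K.ca Y ⊗≫ ((K.H ⊗ K.H ⊗ Y) ◁ K.comul ≫
          (K.H ◁ (β_ K.H Y).hom ≫ (α_ _ _ _).inv ≫ (β_ K.H Y).hom ▷ K.H ≫ (α_ _ _ _).hom) ▷
            (K.H ⊗ K.H)) ⊗≫ Y ◁ K.H ◁ (β_ K.H K.H).hom ▷ K.H ⊗≫
          Y ◁ ((K.H ⊗ K.H) ◁ K.mul ≫ K.mul ▷ K.H) := by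
        rw [whisker_exchange]; monoidal
    _ = (K.comul ▷ Y ≫ (K.H ⊗ K.H) ◁ K.ca Y) ⊗≫
          (K.H ◁ (β_ K.H Y).hom ≫ (α_ _ _ _).inv ≫ (β_ K.H Y).hom ▷ K.H ≫ (α_ _ _ _).hom) ▷
            K.H ⊗≫ Y ◁ (K.H ⊗ K.H) ◁ K.comul ⊗≫ Y ◁ K.H ◁ (β_ K.H K.H).hom ▷ K.H ⊗≫
          Y ◁ (K.mul ▷ (K.H ⊗ K.H) ≫ K.H ◁ K.mul) := by
        rw [whisker_exchange _ K.comul, whisker_exchange K.mul]; monoidal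
    _ = K.H ◁ K.ca Y ⊗≫ (K.comul ▷ Y ≫ (α_ _ _ _).hom ≫
          K.H ◁ (β_ K.H Y).hom ≫ (α_ _ _ _).inv ≫ (β_ K.H Y).hom ▷ K.H ≫ (α_ _ _ _).hom) ▷
            K.H ⊗≫ Y ◁ (K.H ⊗ K.H) ◁ K.comul ⊗≫ Y ◁ K.H ◁ (β_ K.H K.H).hom ▷ K.H ⊗≫
          Y ◁ (K.mul ▷ (K.H ⊗ K.H) ≫ K.H ◁ K.mul) := by
        rw [← whisker_exchange K.comul]; monoidal
    _ = _ := by rw [h2]; monoidal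

theorem unit_comul : K.unit ≫ K.comul = (λ_ _).inv ≫ K.unit ▷ 𝟙_ B ≫ K.H ◁ K.unit := by
  have h : K.ca (𝟙_ B) = K.unit ≫ (λ_ _).inv := by unfold unit; simp
  calc _ = (K.ca (𝟙_ B) ≫ 𝟙_ B ◁ K.comul) ≫ (λ_ _).hom := by rw [h]; monoidal
    _ = (λ_ _).inv ≫ (𝟙_ B ◁ K.unit ≫ K.unit ▷ _) := by rw [ca_comul, h]; monoidal
    _ = _ := by rw [whisker_exchange]

theorem unit_counit : K.unit ≫ K.counit = 𝟙 _ := by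
  unfold unit
  calc _ = (K.ca (𝟙_ B) ≫ 𝟙_ B ◁ K.counit) ≫ (λ_ _).hom := by monoidal
    _ = _ := by rw [ca_counit]; monoidal

/-- The algebra structure of `H`. -/
instance : MonObj K.H where
  one := K.unit
  mul := K.mul
  one_mul := K.unit_mul
  mul_one := K.mul_unit
  mul_assoc := K.mul_assoc'

/-- The coalgebra structure of `H`. -/
instance : ComonObj K.H where
  counit := K.counit
  comul := K.comul
  counit_comul := K.counit_comul
  comul_counit := K.comul_counit
  comul_assoc := K.comul_assoc

/-- `H` is a bialgebra in the braided category `B`. -/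
instance : BimonObj K.H where
  mul_comul := by
    change K.mul ≫ K.comul = (K.comul ⊗ₘ K.comul) ≫ _ ≫ (K.mul ⊗ₘ K.mul)
    rw [mul_comul', tensorμ, MonoidalCategory.tensorHom_def, MonoidalCategory.tensorHom_def]; monoidal
  one_comul := K.unit_comul.trans (by
    change _ = (λ_ _).inv ≫ (K.unit ⊗ₘ K.unit)
    rw [MonoidalCategory.tensorHom_def])
  mul_counit := K.mul_counit'.trans (by
    change _ = (K.counit ⊗ₘ K.counit) ≫ (λ_ _).hom
    rw [MonoidalCategory.tensorHom_def]; monoidal)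
  one_counit := K.unit_counit

/-- The half-braiding `σ` of `H`. With it, `H` is an object of the Drinfeld center. -/
def halfBraiding : HalfBraiding K.H where
  β Y := { hom := K.sig Y, inv := K.tau Y, hom_inv_id := K.sig_tau Y, inv_hom_id := K.tau_sig Y }
  monoidal Y Z := by
    change K.sig (Y ⊗ Z) = (α_ _ _ _).inv ≫ K.sig Y ▷ Z ≫ (α_ _ _ _).hom ≫ Y ◁ K.sig Z ≫ (α_ _ _ _).inv
    rw [sig_tensor]; monoidal
  naturality f := K.sig_nat f

/-- The algebra `H` is an algebra in the Drinfeld center. -/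
instance : CentralMonoid K.halfBraiding where
  one_comm := K.unit_sig
  mul_comm := K.mul_sig

/-- The reconstructed bialgebra `H` is a Hopf algebra: it has an antipode. -/
def IsHopf : Prop :=
  ∃ S : K.H ⟶ K.H, Δ[K.H] ≫ S ▷ K.H ≫ μ[K.H] = ε[K.H] ≫ η[K.H] ∧
    Δ[K.H] ≫ K.H ◁ S ≫ μ[K.H] = ε[K.H] ≫ η[K.H]

end StrongCoend

section RMod

variable {B : Type u} [Category.{v} B] [MonoidalCategory B]

/-- Right modules over an algebra `A` in a monoidal category. -/
structure RMod (A : B) [MonObj A] where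
  /-- the underlying object -/
  X : B
  /-- the action -/
  act : X ⊗ A ⟶ X
  act_one : X ◁ η[A] ≫ act = (ρ_ X).hom
  act_mul : X ◁ μ[A] ≫ act = (α_ X A A).inv ≫ act ▷ A ≫ act

namespace RMod

variable {A : B} [MonObj A]

/-- Morphisms of right `A`-modules. -/
@[ext]
structure Hom (M N : RMod A) where
  /-- the underlying morphism -/
  hom : M.X ⟶ N.X
  act_hom : M.act ≫ hom = hom ▷ A ≫ N.act

instance : Category (RMod A) where
  Hom M N := Hom M N
  id M := ⟨𝟙 M.X, by simp⟩
  comp f g := ⟨f.hom ≫ g.hom, by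
    rw [← Category.assoc, f.act_hom, Category.assoc, g.act_hom]; simp⟩

@[ext]
theorem hom_ext {M N : RMod A} {f g : M ⟶ N} (h : f.hom = g.hom) : f = g := Hom.ext h

@[simp] theorem id_hom (M : RMod A) : Hom.hom (𝟙 M) = 𝟙 M.X := rfl
@[simp] theorem comp_hom {M N P : RMod A} (f : M ⟶ N) (g : N ⟶ P) :
    Hom.hom (f ≫ g) = f.hom ≫ g.hom := rfl

/-- An isomorphism of underlying objects compatible with the actions. -/
def mkIso {M N : RMod A} (e : M.X ≅ N.X) (h : M.act ≫ e.hom = e.hom ▷ A ≫ N.act) : M ≅ N where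
  hom := ⟨e.hom, h⟩
  inv := ⟨e.inv, by rw [Iso.comp_inv_eq, Category.assoc, h]; simp⟩
  hom_inv_id := by ext; simp
  inv_hom_id := by ext; simp

/-- The right `A`-module `Y ⊗ M`. -/
def tens (Y : B) (M : RMod A) : RMod A where
  X := Y ⊗ M.X
  act := (α_ Y M.X A).hom ≫ Y ◁ M.act
  act_one := by
    calc _ = 𝟙 _ ⊗≫ Y ◁ (M.X ◁ η[A] ≫ M.act) := by monoidal
      _ = _ := by rw [M.act_one]; monoidal
  act_mul := by
    calc _ = 𝟙 _ ⊗≫ Y ◁ (M.X ◁ μ[A] ≫ M.act) := by monoidal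
      _ = _ := by rw [M.act_mul]; monoidal

/-- The category of right `A`-modules is a left `B`-module category. -/
instance : MonoidalLeftAction B (RMod A) where
  actionObj Y M := M.tens Y
  actionHomLeft f M := ⟨f ▷ M.X, by
    change ((α_ _ _ _).hom ≫ _ ◁ M.act) ≫ _ = _ ≫ (α_ _ _ _).hom ≫ _ ◁ M.act
    rw [Category.assoc, whisker_exchange]; monoidal⟩
  actionHomRight Y {M N} f := ⟨Y ◁ f.hom, by
    change ((α_ _ _ _).hom ≫ _ ◁ M.act) ≫ _ = _ ≫ (α_ _ _ _).hom ≫ _ ◁ N.act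
    rw [Category.assoc, ← MonoidalCategory.whiskerLeft_comp, f.act_hom]; monoidal⟩
  actionAssocIso X Y M := mkIso (α_ X Y M.X) (by
    change ((α_ _ _ _).hom ≫ _ ◁ M.act) ≫ _ = _ ≫ (α_ _ _ _).hom ≫ _ ◁ ((α_ _ _ _).hom ≫ _ ◁ M.act)
    monoidal)
  actionUnitIso M := mkIso (λ_ M.X) (by
    change ((α_ _ _ _).hom ≫ _ ◁ M.act) ≫ _ = _ ≫ M.act
    monoidal)
  actionHom_def f g := rfl
  actionHomRight_id c M := by
    ext; exact MonoidalCategory.whiskerLeft_id _ _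
  id_actionHomLeft c M := by
    ext; exact id_whiskerRight _ _
  actionHom_comp f₁ f₂ g₁ g₂ := by
    ext
    change (f₁ ≫ f₂) ▷ _ ≫ _ ◁ (g₁.hom ≫ g₂.hom) = (f₁ ▷ _ ≫ _ ◁ g₁.hom) ≫ (f₂ ▷ _ ≫ _ ◁ g₂.hom)
    simp [whisker_exchange_assoc]
  actionAssocIso_hom_naturality f g h := by
    ext
    change ((f ⊗ₘ g) ▷ _ ≫ _ ◁ h.hom) ≫ (α_ _ _ _).hom =
      (α_ _ _ _).hom ≫ f ▷ _ ≫ _ ◁ (g ▷ _ ≫ _ ◁ h.hom)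
    rw [MonoidalCategory.tensorHom_def]; monoidal
  actionUnitIso_hom_naturality f := by
    ext
    exact (leftUnitor_naturality f.hom).symm
  whiskerLeft_actionHomLeft c _ _ f M := by
    ext
    change (c ◁ f) ▷ _ = (α_ _ _ _).hom ≫ c ◁ f ▷ _ ≫ (α_ _ _ _).inv
    monoidal
  whiskerRight_actionHomLeft c f M := by
    ext
    change (f ▷ _) ▷ _ = (α_ _ _ _).hom ≫ f ▷ _ ≫ (α_ _ _ _).inv
    monoidal
  associator_actionHom a b c M := by
    ext
    exact pentagon _ _ _ _
  leftUnitor_actionHom c M := by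
    ext
    change (λ_ c).hom ▷ M.X = (α_ _ _ _).hom ≫ (λ_ _).hom
    monoidal
  rightUnitor_actionHom c M := by
    ext
    change (ρ_ c).hom ▷ M.X = (α_ _ _ _).hom ≫ c ◁ (λ_ _).hom
    monoidal

/-- Restriction of scalars along an algebra map. -/
def restrict {A A' : B} [MonObj A] [MonObj A'] (i : A ⟶ A') [IsMonHom i] : RMod A' ⥤ RMod A where
  obj M := 
    { X := M.X
      act := M.X ◁ i ≫ M.act
      act_one := by
        rw [← MonoidalCategory.whiskerLeft_comp_assoc, IsMonHom.one_hom, M.act_one]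
      act_mul := by
        calc _ = 𝟙 _ ⊗≫ M.X ◁ i ▷ A ⊗≫ (M.X ⊗ A') ◁ i ⊗≫ (M.X ◁ μ[A'] ≫ M.act) := by
              rw [← MonoidalCategory.whiskerLeft_comp_assoc, IsMonHom.mul_hom,
                MonoidalCategory.tensorHom_def]
              monoidal
          _ = 𝟙 _ ⊗≫ M.X ◁ i ▷ A ⊗≫ ((M.X ⊗ A') ◁ i ≫ M.act ▷ A') ⊗≫ M.act := by
              rw [M.act_mul]; monoidal
          _ = _ := by rw [whisker_exchange]; monoidal }
  map {M N} f := ⟨f.hom, by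
    change (M.X ◁ i ≫ M.act) ≫ f.hom = f.hom ▷ A ≫ N.X ◁ i ≫ N.act
    rw [Category.assoc, f.act_hom, whisker_exchange_assoc]⟩

/-- For an algebra map `g : H ⟶ R` and a right `R`-module `V`, the morphism
`X ⊗ V ⟶ X ⊗ H ⊗ V ⟶ X ⊗ V ⊗ H ⟶ X ⊗ V ⊗ R ⟶ X ⊗ V` composed of the coaction `δ_X`, the
half-braiding `σ_V`, the map `g`, and the action. -/
def coactBraid [BraidedCategory B] (K : StrongCoend B) {R : B} [MonObj R] (g : K.H ⟶ R) (X : B)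
    (V : RMod R) : X ⊗ V.X ⟶ X ⊗ V.X :=
  K.ca X ▷ V.X ≫ (α_ X K.H V.X).hom ≫ X ◁ (K.halfBraiding.β V.X).hom ≫ X ◁ V.X ◁ g ≫
    X ◁ V.act

end RMod

end RMod

section ReflectiveCenter

open MonoidalLeftAction

variable (B : Type u) [Category.{v} B] [MonoidalCategory B] [BraidedCategory B]

/-- A module braiding on a left `B`-module category `M`, turning it into a braided module
category. -/
@[ext]
structure ModuleBraiding (M : Type*) [Category* M] [MonoidalLeftAction B M] where
  /-- the natural isomorphism `e_{X,V}` -/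
  e : ∀ (X : B) (V : M), (X ⊙ₗ V : M) ≅ X ⊙ₗ V
  naturality_left : ∀ {X Y : B} (f : X ⟶ Y) (V : M),
    f ⊵ₗ V ≫ (e Y V).hom = (e X V).hom ≫ f ⊵ₗ V
  naturality_right : ∀ (X : B) {V W : M} (g : V ⟶ W),
    X ⊴ₗ g ≫ (e X W).hom = (e X V).hom ≫ X ⊴ₗ g
  tensor_left : ∀ (X Y : B) (V : M), (e (X ⊗ Y) V).hom =
    (β_ Y X).inv ⊵ₗ V ≫ (αₗ Y X V).hom ≫ Y ⊴ₗ (e X V).hom ≫ (αₗ Y X V).inv ≫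
      (β_ Y X).hom ⊵ₗ V ≫ (αₗ X Y V).hom ≫ X ⊴ₗ (e Y V).hom ≫ (αₗ X Y V).inv
  action_right : ∀ (X Y : B) (V : M), (e X (Y ⊙ₗ V)).hom =
    (αₗ X Y V).inv ≫ (β_ X Y).hom ⊵ₗ V ≫ (αₗ Y X V).hom ≫ Y ⊴ₗ (e X V).hom ≫
      (αₗ Y X V).inv ≫ (β_ Y X).hom ⊵ₗ V ≫ (αₗ X Y V).hom

/-- The objects of the reflective center of a left `B`-module category `M`. -/
structure ReflectiveCenter (M : Type*) [Category* M] [MonoidalLeftAction B M] where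
  /-- the underlying object -/
  obj : M
  /-- the isomorphism `e_X`, natural in `X` -/
  e : ∀ X : B, (X ⊙ₗ obj : M) ≅ X ⊙ₗ obj
  naturality : ∀ {X Y : B} (f : X ⟶ Y), f ⊵ₗ obj ≫ (e Y).hom = (e X).hom ≫ f ⊵ₗ obj
  unit : (e (𝟙_ B)).hom = 𝟙 _
  tensor : ∀ X Y : B, (e (X ⊗ Y)).hom =
    (β_ Y X).inv ⊵ₗ obj ≫ (αₗ Y X obj).hom ≫ Y ⊴ₗ (e X).hom ≫ (αₗ Y X obj).inv ≫
      (β_ Y X).hom ⊵ₗ obj ≫ (αₗ X Y obj).hom ≫ X ⊴ₗ (e Y).hom ≫ (αₗ X Y obj).inv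

namespace ReflectiveCenter

variable {B} {M : Type*} [Category* M] [MonoidalLeftAction B M]

/-- Morphisms in the reflective center. -/
@[ext]
structure Hom (V W : ReflectiveCenter B M) where
  /-- the underlying morphism -/
  hom : V.obj ⟶ W.obj
  comm : ∀ X : B, X ⊴ₗ hom ≫ (W.e X).hom = (V.e X).hom ≫ X ⊴ₗ hom

instance : Category (ReflectiveCenter B M) where
  Hom V W := Hom V W
  id V := ⟨𝟙 V.obj, by simp⟩
  comp f g := ⟨f.hom ≫ g.hom, fun X => by
    rw [actionHomRight_comp, Category.assoc, g.comm, ← Category.assoc, f.comm, Category.assoc]⟩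

@[ext]
theorem hom_ext {V W : ReflectiveCenter B M} {f g : V ⟶ W} (h : f.hom = g.hom) : f = g :=
  Hom.ext h

@[simp] theorem id_hom (V : ReflectiveCenter B M) : Hom.hom (𝟙 V) = 𝟙 V.obj := rfl

@[simp] theorem comp_hom {U V W : ReflectiveCenter B M} (f : U ⟶ V) (g : V ⟶ W) :
    Hom.hom (f ≫ g) = f.hom ≫ g.hom := rfl

variable (B M) in
/-- The forgetful functor. -/
@[simps]
def forget : ReflectiveCenter B M ⥤ M where
  obj V := V.obj
  map f := f.hom

/-- An isomorphism of underlying objects compatible with the `e`'s. -/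
def mkIso {V W : ReflectiveCenter B M} (i : V.obj ≅ W.obj)
    (h : ∀ X : B, X ⊴ₗ i.hom ≫ (W.e X).hom = (V.e X).hom ≫ X ⊴ₗ i.hom) : V ≅ W where
  hom := ⟨i.hom, h⟩
  inv := ⟨i.inv, fun X => by
    rw [← cancel_epi (X ⊴ₗ i.hom), ← cancel_mono (X ⊴ₗ i.hom)]
    simp [h]⟩
  hom_inv_id := by ext; simp
  inv_hom_id := by ext; simp

/-- `W ⊗ e_X`, acting on `(W ⊗ X) ⊙ V`. -/
def ins (V : ReflectiveCenter B M) (W X : B) : ((W ⊗ X) ⊙ₗ V.obj : M) ⟶ (W ⊗ X) ⊙ₗ V.obj :=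
  (αₗ W X V.obj).hom ≫ W ⊴ₗ (V.e X).hom ≫ (αₗ W X V.obj).inv

theorem ins_nat (V : ReflectiveCenter B M) {W W' : B} (f : W ⟶ W') (X : B) :
    (f ▷ X) ⊵ₗ V.obj ≫ V.ins W' X = V.ins W X ≫ (f ▷ X) ⊵ₗ V.obj := by
  simp only [ins, whiskerRight_actionHomLeft, Category.assoc, Iso.inv_hom_id_assoc]
  rw [← action_exchange_assoc]

theorem ins_conj (V : ReflectiveCenter B M) {W W' : B} (f : W ≅ W') (X : B) :
    V.ins W X = (f.hom ▷ X) ⊵ₗ V.obj ≫ V.ins W' X ≫ (f.inv ▷ X) ⊵ₗ V.obj := by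
  rw [← Category.assoc, ins_nat, Category.assoc, ← comp_actionHomLeft, ← comp_whiskerRight]
  simp

theorem whisker_ins (V : ReflectiveCenter B M) (Z W X : B) :
    (αₗ Z (W ⊗ X) V.obj).hom ≫ Z ⊴ₗ V.ins W X ≫ (αₗ Z (W ⊗ X) V.obj).inv =
      (α_ Z W X).inv ⊵ₗ V.obj ≫ V.ins (Z ⊗ W) X ≫ (α_ Z W X).hom ⊵ₗ V.obj := by
  have h := associator_actionHom Z W X V.obj
  rw [← cancel_epi ((α_ Z W X).hom ⊵ₗ V.obj), ← cancel_mono ((αₗ Z (W ⊗ X) V.obj).hom),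
    ← cancel_mono (Z ⊴ₗ (αₗ W X V.obj).hom)]
  simp only [ins, actionHomRight_comp, Category.assoc, Iso.inv_hom_id_assoc, h,
    actionHomRight_inv_hom, Category.comp_id, hom_inv_actionHomLeft_assoc, Iso.inv_hom_id,
    tensor_actionHomRight, associator_actionHom_assoc]

/-- The components of the braiding on `Y ⊙ V`. -/
def actIso (Y : B) (V : ReflectiveCenter B M) (X : B) :
    (X ⊙ₗ Y ⊙ₗ V.obj : M) ≅ X ⊙ₗ Y ⊙ₗ V.obj where
  hom := (αₗ X Y V.obj).inv ≫ (β_ X Y).hom ⊵ₗ V.obj ≫ (αₗ Y X V.obj).hom ≫ Y ⊴ₗ (V.e X).hom ≫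
      (αₗ Y X V.obj).inv ≫ (β_ Y X).hom ⊵ₗ V.obj ≫ (αₗ X Y V.obj).hom
  inv := (αₗ X Y V.obj).inv ≫ (β_ Y X).inv ⊵ₗ V.obj ≫ (αₗ Y X V.obj).hom ≫ Y ⊴ₗ (V.e X).inv ≫
      (αₗ Y X V.obj).inv ≫ (β_ X Y).inv ⊵ₗ V.obj ≫ (αₗ X Y V.obj).hom
  hom_inv_id := by simp
  inv_hom_id := by simp

theorem actIso_hom (Y : B) (V : ReflectiveCenter B M) (X : B) :
    (actIso Y V X).hom = (αₗ X Y V.obj).inv ≫ ((β_ X Y).hom ⊵ₗ V.obj ≫ V.ins Y X ≫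
      (β_ Y X).hom ⊵ₗ V.obj) ≫ (αₗ X Y V.obj).hom := by
  simp [actIso, ins]

theorem tensor' (V : ReflectiveCenter B M) (X Y : B) : (V.e (X ⊗ Y)).hom =
    (β_ Y X).inv ⊵ₗ V.obj ≫ V.ins Y X ≫ (β_ Y X).hom ⊵ₗ V.obj ≫ V.ins X Y := by
  rw [V.tensor]; simp [ins]

theorem ins_tensor (V : ReflectiveCenter B M) (Y X X' : B) : V.ins Y (X ⊗ X') =
    (Y ◁ (β_ X' X).inv ≫ (α_ Y X' X).inv) ⊵ₗ V.obj ≫ V.ins (Y ⊗ X') X ≫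
      ((α_ Y X' X).hom ≫ Y ◁ (β_ X' X).hom ≫ (α_ Y X X').inv) ⊵ₗ V.obj ≫
      V.ins (Y ⊗ X) X' ≫ (α_ Y X X').hom ⊵ₗ V.obj := by
  conv_lhs => rw [ins, tensor']
  have h1 := V.whisker_ins Y X' X
  have h2 := V.whisker_ins Y X X'
  simp only [comp_actionHomLeft, Category.assoc]
  rw [← h2]
  rw [reassoc_of% h1.symm]
  simp

theorem conj_act (Z' Z Y : B) (V : M) (k : ((Z ⊗ Y) ⊙ₗ V : M) ⟶ (Z ⊗ Y) ⊙ₗ V) :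
    (αₗ Z' Z (Y ⊙ₗ V)).hom ≫ Z' ⊴ₗ ((αₗ Z Y V).inv ≫ k ≫ (αₗ Z Y V).hom) ≫
      (αₗ Z' Z (Y ⊙ₗ V)).inv =
    (αₗ (Z' ⊗ Z) Y V).inv ≫ (α_ Z' Z Y).hom ⊵ₗ V ≫ ((αₗ Z' (Z ⊗ Y) V).hom ≫ Z' ⊴ₗ k ≫
      (αₗ Z' (Z ⊗ Y) V).inv) ≫ (α_ Z' Z Y).inv ⊵ₗ V ≫ (αₗ (Z' ⊗ Z) Y V).hom := by
  have h := associator_actionHom Z' Z Y V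
  rw [← cancel_epi ((αₗ (Z' ⊗ Z) Y V).hom), ← cancel_mono (αₗ Z' Z (Y ⊙ₗ V)).hom]
  simp only [Category.assoc, Iso.hom_inv_id_assoc, Iso.inv_hom_id, Category.comp_id,
    actionHomRight_comp]
  rw [← h]
  simp only [inv_hom_actionHomLeft_assoc, Iso.inv_hom_id_assoc]
  rw [reassoc_of% h.symm]
  simp

theorem key_act (V : ReflectiveCenter B M) (Y Z Z' : B) :
    (αₗ Z' Z (Y ⊙ₗ V.obj)).hom ≫ Z' ⊴ₗ (actIso Y V Z).hom ≫ (αₗ Z' Z (Y ⊙ₗ V.obj)).inv =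
      (αₗ (Z' ⊗ Z) Y V.obj).inv ≫ ((α_ Z' Z Y).hom ≫ Z' ◁ (β_ Z Y).hom ≫ (α_ Z' Y Z).inv) ⊵ₗ V.obj
       ≫ V.ins (Z' ⊗ Y) Z ≫
       ((α_ Z' Y Z).hom ≫ Z' ◁ (β_ Y Z).hom ≫ (α_ Z' Z Y).inv) ⊵ₗ V.obj ≫
        (αₗ (Z' ⊗ Z) Y V.obj).hom := by
  rw [actIso_hom, conj_act]
  have h1 := V.whisker_ins Z' Y Z
  have h2 : V.ins (Z' ⊗ Y) Z = (α_ Z' Y Z).hom ⊵ₗ V.obj ≫ ((αₗ Z' (Y ⊗ Z) V.obj).hom ≫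
      Z' ⊴ₗ V.ins Y Z ≫ (αₗ Z' (Y ⊗ Z) V.obj).inv) ≫ (α_ Z' Y Z).inv ⊵ₗ V.obj := by
    rw [h1]; simp
  rw [h2]
  simp only [comp_actionHomLeft, Category.assoc, actionHomRight_comp, whiskerLeft_actionHomLeft,
    Iso.inv_hom_id_assoc, hom_inv_actionHomLeft_assoc, inv_hom_actionHomLeft_assoc]

theorem comp3 {a b c : B} (f : a ⟶ b) (g : b ⟶ c) (V : M) {W : M} (h : (c ⊙ₗ V : M) ⟶ W) :
    f ⊵ₗ V ≫ g ⊵ₗ V ≫ h = (f ≫ g) ⊵ₗ V ≫ h := by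
  rw [comp_actionHomLeft, Category.assoc]

theorem yb1 (X X' Y : B) :
    ((β_ (X ⊗ X') Y).hom ≫ Y ◁ (β_ X' X).inv ≫ (α_ Y X' X).inv) ≫ (β_ X' Y).inv ▷ X =
      (β_ X' X).inv ▷ Y ≫ (α_ X' X Y).hom ≫ X' ◁ (β_ X Y).hom ≫ (α_ X' Y X).inv := by
  rw [← braiding_naturality_left_assoc, braiding_tensor_left_hom]
  simp

theorem yb2 (X X' Y : B) :
    (β_ X' Y).hom ▷ X ≫ ((α_ Y X' X).hom ≫ Y ◁ (β_ X' X).hom ≫ (α_ Y X X').inv) ≫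
      (β_ Y X).hom ▷ X' =
      ((α_ X' Y X).hom ≫ X' ◁ (β_ Y X).hom ≫ (α_ X' X Y).inv) ≫ (β_ X' X).hom ▷ Y ≫
        (α_ X X' Y).hom ≫ X ◁ (β_ X' Y).hom ≫ (α_ X Y X').inv := by
  have := yang_baxter X' Y X
  simp only [← Category.assoc] at this ⊢
  rw [← cancel_mono (α_ X Y X').hom, ← cancel_epi (α_ X' Y X).inv]
  simpa using this

theorem yb3 (X X' Y : B) :
    (β_ Y X).inv ▷ X' ≫ (α_ Y X X').hom ≫ (β_ Y (X ⊗ X')).hom =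
      (α_ X Y X').hom ≫ X ◁ (β_ Y X').hom ≫ (α_ X X' Y).inv := by
  rw [braiding_tensor_right_hom]
  simp

theorem actIso_tensor (Y : B) (V : ReflectiveCenter B M) (X X' : B) :
    (actIso Y V (X ⊗ X')).hom =
    (β_ X' X).inv ⊵ₗ (Y ⊙ₗ V.obj) ≫ (αₗ X' X (Y ⊙ₗ V.obj)).hom ≫ X' ⊴ₗ (actIso Y V X).hom ≫
      (αₗ X' X (Y ⊙ₗ V.obj)).inv ≫
      (β_ X' X).hom ⊵ₗ (Y ⊙ₗ V.obj) ≫ (αₗ X X' (Y ⊙ₗ V.obj)).hom ≫ X ⊴ₗ (actIso Y V X').hom ≫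
        (αₗ X X' (Y ⊙ₗ V.obj)).inv := by
  have k1 := key_act V Y X X'
  have k2 := key_act V Y X' X
  have n1 : ∀ {W W' : B} (f : W ⟶ W'), f ⊵ₗ (Y ⊙ₗ V.obj) =
      (αₗ W Y V.obj).inv ≫ (f ▷ Y) ⊵ₗ V.obj ≫ (αₗ W' Y V.obj).hom := by
    intro W W' f
    rw [whiskerRight_actionHomLeft]
    simp only [Category.assoc, Iso.inv_hom_id, Iso.inv_hom_id_assoc, Category.comp_id]
  rw [k2, reassoc_of% k1, actIso_hom, ins_tensor, V.ins_conj (β_ X' Y).symm X,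
    V.ins_conj (β_ Y X) X', n1, n1]
  simp only [Category.assoc, Iso.hom_inv_id_assoc, comp3, Iso.symm_hom, Iso.symm_inv]
  have y1 := yb1 X X' Y
  have y2 := yb2 X X' Y
  have y3 := yb3 X X' Y
  simp only [Category.assoc] at y1 y2 y3
  rw [y1, y2, y3]

theorem actIso_unit (Y : B) (V : ReflectiveCenter B M) : (actIso Y V (𝟙_ B)).hom = 𝟙 _ := by
  have h : V.ins Y (𝟙_ B) = 𝟙 _ := by
    simp only [ins, V.unit, actionHomRight_id, Category.id_comp, Iso.hom_inv_id]
  rw [actIso_hom, h, Category.id_comp, ← comp_actionHomLeft]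
  simp only [braiding_tensorUnit_left, braiding_tensorUnit_right, Category.assoc,
    Iso.inv_hom_id_assoc, Iso.hom_inv_id, id_actionHomLeft, Category.id_comp, Iso.inv_hom_id]

theorem actIso_naturality (Y : B) (V : ReflectiveCenter B M) {X X' : B} (f : X ⟶ X') :
    f ⊵ₗ (Y ⊙ₗ V.obj) ≫ (actIso Y V X').hom = (actIso Y V X).hom ≫ f ⊵ₗ (Y ⊙ₗ V.obj) := by
  have n1 : ∀ {W W' : B} (f : W ⟶ W'), f ⊵ₗ (Y ⊙ₗ V.obj) =
      (αₗ W Y V.obj).inv ≫ (f ▷ Y) ⊵ₗ V.obj ≫ (αₗ W' Y V.obj).hom := by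
    intro W W' f
    rw [whiskerRight_actionHomLeft]
    simp only [Category.assoc, Iso.inv_hom_id, Iso.inv_hom_id_assoc, Category.comp_id]
  have n2 : (Y ◁ f) ⊵ₗ V.obj ≫ V.ins Y X' = V.ins Y X ≫ (Y ◁ f) ⊵ₗ V.obj := by
    simp only [ins, whiskerLeft_actionHomLeft, Category.assoc, Iso.inv_hom_id_assoc,
      ← actionHomRight_comp_assoc, V.naturality]
  rw [n1, actIso_hom, actIso_hom]
  simp only [Category.assoc, Iso.hom_inv_id_assoc, comp3, braiding_naturality_left]
  rw [comp_actionHomLeft, Category.assoc, reassoc_of% n2, comp3, braiding_naturality_right]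

/-- The object `Y ⊙ V` with its braiding. -/
def act (Y : B) (V : ReflectiveCenter B M) : ReflectiveCenter B M where
  obj := Y ⊙ₗ V.obj
  e := actIso Y V
  naturality := actIso_naturality Y V
  unit := actIso_unit Y V
  tensor := actIso_tensor Y V

theorem act_comm_left {Y Y' : B} (f : Y ⟶ Y') (V : ReflectiveCenter B M) (X : B) :
    X ⊴ₗ (f ⊵ₗ V.obj) ≫ (actIso Y' V X).hom = (actIso Y V X).hom ≫ X ⊴ₗ (f ⊵ₗ V.obj) := by
  have n1 : X ⊴ₗ (f ⊵ₗ V.obj) =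
      (αₗ X Y V.obj).inv ≫ (X ◁ f) ⊵ₗ V.obj ≫ (αₗ X Y' V.obj).hom := by
    rw [whiskerLeft_actionHomLeft]
    simp only [Category.assoc, Iso.inv_hom_id, Iso.inv_hom_id_assoc, Category.comp_id]
  rw [n1, actIso_hom, actIso_hom]
  simp only [Category.assoc, Iso.hom_inv_id_assoc, comp3, braiding_naturality_right]
  rw [comp_actionHomLeft, Category.assoc, reassoc_of% (V.ins_nat f X), comp3,
    braiding_naturality_left]

theorem act_comm_right (Y : B) {V W : ReflectiveCenter B M} (f : V ⟶ W) (X : B) :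
    X ⊴ₗ (Y ⊴ₗ Hom.hom f) ≫ (actIso Y W X).hom =
      (actIso Y V X).hom ≫ X ⊴ₗ (Y ⊴ₗ Hom.hom f) := by
  have n1 : ∀ X Y : B, X ⊴ₗ (Y ⊴ₗ Hom.hom f) =
      (αₗ X Y V.obj).inv ≫ (X ⊗ Y) ⊴ₗ Hom.hom f ≫ (αₗ X Y W.obj).hom := by
    intro X Y
    rw [tensor_actionHomRight]
    simp only [Category.assoc, Iso.inv_hom_id, Iso.inv_hom_id_assoc, Category.comp_id]
  have n2 : (Y ⊗ X) ⊴ₗ Hom.hom f ≫ W.ins Y X = V.ins Y X ≫ (Y ⊗ X) ⊴ₗ Hom.hom f := by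
    simp only [ins, tensor_actionHomRight, Category.assoc, Iso.inv_hom_id_assoc]
    rw [← actionHomRight_comp_assoc, f.comm, actionHomRight_comp_assoc]
  rw [n1, actIso_hom, actIso_hom]
  simp only [Category.assoc, Iso.hom_inv_id_assoc, action_exchange_assoc]
  rw [reassoc_of% n2, action_exchange_assoc]

theorem act_comm_assoc (Y Z : B) (V : ReflectiveCenter B M) (X : B) :
    X ⊴ₗ (αₗ Y Z V.obj).hom ≫ (actIso Y (act Z V) X).hom =
      (actIso (Y ⊗ Z) V X).hom ≫ X ⊴ₗ (αₗ Y Z V.obj).hom := by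
  have h : (act Z V).ins Y X = (αₗ (Y ⊗ X) Z V.obj).inv ≫
      ((α_ Y X Z).hom ≫ Y ◁ (β_ X Z).hom ≫ (α_ Y Z X).inv) ⊵ₗ V.obj
       ≫ V.ins (Y ⊗ Z) X ≫
       ((α_ Y Z X).hom ≫ Y ◁ (β_ Z X).hom ≫ (α_ Y X Z).inv) ⊵ₗ V.obj ≫
        (αₗ (Y ⊗ X) Z V.obj).hom := key_act V Z X Y
  have n1 : ∀ {W W' : B} (f : W ⟶ W'), f ⊵ₗ (Z ⊙ₗ V.obj) =
      (αₗ W Z V.obj).inv ≫ (f ▷ Z) ⊵ₗ V.obj ≫ (αₗ W' Z V.obj).hom := by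
    intro W W' f
    rw [whiskerRight_actionHomLeft]
    simp only [Category.assoc, Iso.inv_hom_id, Iso.inv_hom_id_assoc, Category.comp_id]
  have a1 : X ⊴ₗ (αₗ Y Z V.obj).hom ≫ (αₗ X Y (Z ⊙ₗ V.obj)).inv =
      (αₗ X (Y ⊗ Z) V.obj).inv ≫ (α_ X Y Z).inv ⊵ₗ V.obj ≫ (αₗ (X ⊗ Y) Z V.obj).hom := by
    rw [Iso.comp_inv_eq]
    simp only [Category.assoc]
    rw [← associator_actionHom, inv_hom_actionHomLeft_assoc, Iso.inv_hom_id_assoc]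
  have a2 : (αₗ (X ⊗ Y) Z V.obj).hom ≫ (αₗ X Y (Z ⊙ₗ V.obj)).hom = (α_ X Y Z).hom ⊵ₗ V.obj ≫
      (αₗ X (Y ⊗ Z) V.obj).hom ≫ X ⊴ₗ (αₗ Y Z V.obj).hom := (associator_actionHom X Y Z V.obj).symm
  rw [actIso_hom Y (act Z V) X, actIso_hom, h]
  change _ ≫ (αₗ X Y (Z ⊙ₗ V.obj)).inv ≫ ((β_ X Y).hom ⊵ₗ (Z ⊙ₗ V.obj) ≫ _ ≫
    (β_ Y X).hom ⊵ₗ (Z ⊙ₗ V.obj)) ≫ (αₗ X Y (Z ⊙ₗ V.obj)).hom = _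
  rw [reassoc_of% a1, n1, n1]
  simp only [Category.assoc, Iso.hom_inv_id_assoc, comp3, a2]
  simp only [braiding_tensor_left_hom, braiding_tensor_right_hom]

theorem act_comm_unit (V : ReflectiveCenter B M) (X : B) :
    X ⊴ₗ (λₗ V.obj).hom ≫ (V.e X).hom = (actIso (𝟙_ B) V X).hom ≫ X ⊴ₗ (λₗ V.obj).hom := by
  have h : V.ins (𝟙_ B) X = (λ_ X).hom ⊵ₗ V.obj ≫ (V.e X).hom ≫ (λ_ X).inv ⊵ₗ V.obj := by
    have e : (λ_ X).inv ⊵ₗ V.obj = (λₗ (X ⊙ₗ V.obj)).inv ≫ (αₗ (𝟙_ B) X V.obj).inv := by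
      rw [← cancel_epi ((λ_ X).hom ⊵ₗ V.obj), hom_inv_actionHomLeft, leftUnitor_actionHom]
      simp
    rw [e, leftUnitor_actionHom, ins, unit_actionHomRight]
    simp only [Category.assoc]
  rw [actIso_hom, h]
  have a : X ⊴ₗ (λₗ V.obj).hom = (αₗ X (𝟙_ B) V.obj).inv ≫ (ρ_ X).hom ⊵ₗ V.obj := by
    rw [Iso.eq_inv_comp]; simp
  rw [a]
  simp only [Category.assoc, comp3, Iso.hom_inv_id_assoc]
  simp only [← comp_actionHomLeft]
  simp

/-- The reflective center is a left `B`-module category: the braiding on `Y ⊙ V` is defined by the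
second axiom of a module braiding. -/
instance : MonoidalLeftAction B (ReflectiveCenter B M) where
  actionObj Y V := V.act Y
  actionHomLeft f V := ⟨f ⊵ₗ V.obj, V.act_comm_left f⟩
  actionHomRight Y {V W} f := ⟨Y ⊴ₗ f.hom, act_comm_right Y f⟩
  actionAssocIso Y Z V := mkIso (αₗ Y Z V.obj) (act_comm_assoc Y Z V)
  actionUnitIso V := mkIso (λₗ V.obj) (act_comm_unit V)
  actionHom_def f g := rfl
  actionHomRight_id c V := by
    ext; exact actionHomRight_id _ _
  id_actionHomLeft c V := by
    ext; exact id_actionHomLeft _ _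
  actionHom_comp f₁ f₂ g₁ g₂ := by
    ext
    change (f₁ ≫ f₂) ⊵ₗ _ ≫ _ ⊴ₗ (Hom.hom g₁ ≫ Hom.hom g₂) =
      (f₁ ⊵ₗ _ ≫ _ ⊴ₗ Hom.hom g₁) ≫ (f₂ ⊵ₗ _ ≫ _ ⊴ₗ Hom.hom g₂)
    simp [action_exchange_assoc]
  actionAssocIso_hom_naturality f g h := by
    ext
    have := actionAssocIso_hom_naturality f g (Hom.hom h)
    simp only [actionHom_def] at this
    exact this
  actionUnitIso_hom_naturality f := by
    ext
    exact actionUnitIso_hom_naturality (Hom.hom f)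
  whiskerLeft_actionHomLeft c _ _ f M := by
    ext
    exact whiskerLeft_actionHomLeft _ _ _
  whiskerRight_actionHomLeft c f M := by
    ext
    exact whiskerRight_actionHomLeft _ _ _
  associator_actionHom a b c M := by
    ext
    exact associator_actionHom _ _ _ _
  leftUnitor_actionHom c M := by
    ext
    exact leftUnitor_actionHom _ _
  rightUnitor_actionHom c M := by
    ext
    exact rightUnitor_actionHom _ _

end ReflectiveCenter

end ReflectiveCenter

end

/-!
By the strong universal property of `H`, a family of endomorphisms of `X ⊗ V` that is natural in `X`
is the same as a morphism `p : H ⊗ V ⟶ V` (`actEnd`), and through the half-braiding `σ_V` the same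
as a morphism `r : V ⊗ H ⟶ V` with `p = r σ_V`. The axioms translate as follows.

* The first axiom of a module braiding holds if and only if `p` is associative
  (`actEnd_tensor_iff`), equivalently `r` is associative (`sig_assoc_iff`). A direct translation
  gives associativity only up to the half-braiding of `H` with itself. It disappears because `H` is
  commutative in the Drinfeld center (`sig_mul`), which is naturality of the coaction with respect
  to the braiding of `B`.
* The component at the unit object is the identity if and only if `r` is unital, and this is
  automatic for invertible families (`unit_act_of_isIso`).
* The family is `A`-linear if and only if `r` commutes with the action of `A` up to `σ_A`
  (`actEnd_linear_iff`).
* If `H` has an antipode `S`, the family is invertible, with inverse given by `p (S ⊗ V)`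
  (`actEnd_isIso`).

So an object of the reflective center is an `A`-module with a right action of `H` satisfying the
commutation rule of `A ⊗_σ H` (`CentralAction`, `exists_centralAction`), that is, a module over
`A ⊗_σ H`. The resulting functor is fully faithful and essentially surjective, and it is strictly
compatible with the actions of `B` because the formula for the braiding satisfies the second axiom
(`coactBraid_tens`).

A module braiding gives in particular a central action of `H` on the regular module, and its second
axiom together with naturality for the action maps `V ⊗ A ⟶ V` shows that the action of `H` on every
module `V` is the action of `A` along one morphism `f : H ⟶ A` (`exists_algHom`). The axioms on the
regular module say that `f` is an algebra map with the required commutation rule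
(`algHom_of_centralAction`).
-/

noncomputable section

namespace StrongCoend

variable {B : Type u} [Category.{v} B] [MonoidalCategory B] [BraidedCategory B]
  (K : StrongCoend B)

/-! ### Commutativity of the coendomorphism algebra in the Drinfeld center -/

/-- The algebra `H` is commutative in the Drinfeld center. This expresses that the coaction
`δ_{X ⊗ Y}`, being natural, is compatible with the braiding `X ⊗ Y ⟶ Y ⊗ X`. -/
theorem sig_mul : K.sig K.H ≫ K.mul = K.mul := by
  apply K.ext_strong
  intro X
  apply K.ext_flip
  intro Y
  -- The two sides induce the two sides of `c ≫ δ_{Y ⊗ X} = δ_{X ⊗ Y} ≫ (c ⊗ H)`, `c = c_{X,Y}`.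
  have hl : X ◁ K.ca Y ⊗≫ (β_ X Y).hom ▷ K.H ⊗≫
        Y ◁ (K.ca X ▷ K.H ⊗≫ X ◁ (K.sig K.H ≫ K.mul)) =
      (β_ X Y).hom ≫ K.ca (Y ⊗ X) ⊗≫ 𝟙 (Y ⊗ X ⊗ K.H) := by
    have h := braiding_naturality_right X (K.ca Y)
    rw [braiding_tensor_right_hom] at h
    calc _ = X ◁ K.ca Y ⊗≫ (β_ X Y).hom ▷ K.H ⊗≫
            Y ◁ (K.ca X ▷ K.H ⊗≫ X ◁ K.sig K.H) ⊗≫ (Y ⊗ X) ◁ K.mul ⊗≫ 𝟙 _ := by monoidal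
      _ = (X ◁ K.ca Y ≫ (α_ X Y K.H).inv ≫ (β_ X Y).hom ▷ K.H ≫ (α_ Y X K.H).hom ≫
            Y ◁ (β_ X K.H).hom ≫ (α_ Y K.H X).inv) ⊗≫ Y ◁ K.H ◁ K.ca X ⊗≫
            Y ◁ (β_ K.H X).hom ▷ K.H ⊗≫ (Y ⊗ X) ◁ K.mul ⊗≫ 𝟙 _ := by
          rw [ca_sig]; monoidal
      _ = _ := by rw [h, coact_tensor]; monoidal
  have hr : X ◁ K.ca Y ⊗≫ (β_ X Y).hom ▷ K.H ⊗≫ Y ◁ (K.ca X ▷ K.H ⊗≫ X ◁ K.mul) =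
      K.ca (X ⊗ Y) ≫ (β_ X Y).hom ▷ K.H ⊗≫ 𝟙 (Y ⊗ X ⊗ K.H) := by
    have h := braiding_naturality_left (K.ca X) Y
    rw [braiding_tensor_left_hom] at h
    calc _ = 𝟙 _ ⊗≫ X ◁ K.ca Y ⊗≫ ((β_ X Y).hom ≫ Y ◁ K.ca X) ▷ K.H ⊗≫
            (Y ⊗ X) ◁ K.mul ⊗≫ 𝟙 _ := by monoidal
      _ = 𝟙 _ ⊗≫ (X ◁ K.ca Y ≫ K.ca X ▷ (Y ⊗ K.H)) ⊗≫ X ◁ (β_ K.H Y).hom ▷ K.H ⊗≫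
            ((β_ X Y).hom ▷ (K.H ⊗ K.H) ≫ (Y ⊗ X) ◁ K.mul) ⊗≫ 𝟙 _ := by
          rw [← h]; monoidal
      _ = _ := by rw [whisker_exchange, ← whisker_exchange _ K.mul, coact_tensor]; monoidal
  rw [hl, hr]
  calc _ = ((β_ X Y).hom ≫ K.ca (Y ⊗ X)) ⊗≫ 𝟙 (Y ⊗ X ⊗ K.H) := by monoidal
    _ = _ := by rw [K.ca_nat]; monoidal

theorem tau_mul : K.tau K.H ≫ K.mul = K.mul := by
  conv_lhs => rw [← K.sig_mul, ← Category.assoc, K.tau_sig, Category.id_comp]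

/-- The half-braiding of `H` with itself exchanges the values of a coaction with `H`. -/
theorem ca_flip (Y : B) : K.ca Y ▷ K.H = (β_ Y K.H).hom ≫ K.H ◁ K.ca Y ⊗≫
    (β_ K.H Y).hom ▷ K.H ⊗≫ Y ◁ K.tau K.H ⊗≫ 𝟙 _ := by
  calc _ = (K.ca Y ▷ K.H ⊗≫ Y ◁ K.sig K.H) ⊗≫ Y ◁ K.tau K.H ⊗≫ 𝟙 _ := by
        calc _ = K.ca Y ▷ K.H ⊗≫ Y ◁ (K.sig K.H ≫ K.tau K.H) ⊗≫ 𝟙 _ := by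
              rw [sig_tau]; monoidal
          _ = _ := by monoidal
    _ = _ := by rw [ca_sig]; monoidal

/-! ### Natural endomorphisms of `X ⊗ V` -/

/-- The endomorphism `(X ⊗ p) (δ_X ⊗ V)` of `X ⊗ V`, natural in `X`, that corresponds to a
morphism `p : H ⊗ V ⟶ V` under the strong universal property of `H`. -/
def actEnd {V : B} (p : K.H ⊗ V ⟶ V) (X : B) : X ⊗ V ⟶ X ⊗ V :=
  K.ca X ▷ V ≫ (α_ X K.H V).hom ≫ X ◁ p

variable {K} {V : B}

theorem actEnd_injective {p q : K.H ⊗ V ⟶ V} (h : ∀ X, K.actEnd p X = K.actEnd q X) : p = q := by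
  apply K.ext_strong
  intro X
  simpa [monoidalComp, actEnd] using h X

/-- Surjectivity in the strong universal property of `H`. -/
theorem exists_actEnd (φ : ∀ X : B, X ⊗ V ⟶ X ⊗ V)
    (hφ : ∀ {X Y : B} (k : X ⟶ Y), k ▷ V ≫ φ Y = φ X ≫ k ▷ V) :
    ∃ p : K.H ⊗ V ⟶ V, ∀ X, K.actEnd p X = φ X :=
  ⟨K.desc φ fun _ _ k => hφ k, K.desc_spec φ fun _ _ k => hφ k⟩

theorem actEnd_naturality (p : K.H ⊗ V ⟶ V) {X Y : B} (k : X ⟶ Y) :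
    k ▷ V ≫ K.actEnd p Y = K.actEnd p X ≫ k ▷ V := by
  unfold actEnd
  rw [← comp_whiskerRight_assoc, ca_nat]
  simp [whisker_exchange]


/-- The left-hand side of the first axiom of a module braiding, for `actEnd p`. -/
theorem actEnd_tensor_eq (p : K.H ⊗ V ⟶ V) (X Y : B) :
    K.actEnd p (X ⊗ Y) = (α_ X Y V).hom ≫ (K.ca X ▷ (Y ⊗ V) ⊗≫ X ◁
      (K.H ◁ K.ca Y ▷ V ⊗≫ (β_ K.H Y).hom ▷ (K.H ⊗ V) ⊗≫
        Y ◁ ((α_ _ _ _).inv ≫ K.mul ▷ V ≫ p))) ≫ (α_ X Y V).inv := by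
  unfold actEnd
  rw [coact_tensor]
  monoidal

/-- The right-hand side of the first axiom of a module braiding, for `actEnd p`. -/
theorem braided_actEnd_eq (p : K.H ⊗ V ⟶ V) (X Y : B) :
    (β_ Y X).inv ▷ V ≫ (α_ Y X V).hom ≫ Y ◁ K.actEnd p X ≫ (α_ Y X V).inv ≫
      (β_ Y X).hom ▷ V ≫ (α_ X Y V).hom ≫ X ◁ K.actEnd p Y ≫ (α_ X Y V).inv =
    (α_ X Y V).hom ≫ (K.ca X ▷ (Y ⊗ V) ⊗≫ X ◁
      (K.H ◁ K.ca Y ▷ V ⊗≫ (β_ K.H Y).hom ▷ (K.H ⊗ V) ⊗≫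
        Y ◁ ((α_ _ _ _).inv ≫ K.tau K.H ▷ V ≫ (α_ _ _ _).hom ≫ K.H ◁ p ≫ p))) ≫
          (α_ X Y V).inv := by
  unfold actEnd
  calc _ = 𝟙 _ ⊗≫ (β_ Y X).inv ▷ V ⊗≫ Y ◁ K.ca X ▷ V ⊗≫ ((Y ⊗ X) ◁ p ≫
          (β_ Y X).hom ▷ V) ⊗≫ X ◁ K.ca Y ▷ V ⊗≫ X ◁ Y ◁ p ⊗≫ 𝟙 _ := by monoidal
    _ = 𝟙 _ ⊗≫ (β_ Y X).inv ▷ V ⊗≫ (Y ◁ K.ca X ⊗≫ (β_ Y X).hom ▷ K.H ⊗≫ 𝟙 (X ⊗ Y ⊗ K.H)) ▷ V ⊗≫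
          X ◁ (Y ◁ p ≫ K.ca Y ▷ V) ⊗≫ X ◁ Y ◁ p ⊗≫ 𝟙 _ := by
        rw [whisker_exchange]; monoidal
    _ = 𝟙 _ ⊗≫ ((β_ Y X).inv ≫ (β_ Y X).hom) ▷ V ⊗≫ K.ca X ▷ Y ▷ V ⊗≫ X ◁ (β_ Y K.H).inv ▷ V ⊗≫
          X ◁ (K.ca Y ▷ K.H) ▷ V ⊗≫ X ◁ Y ◁ K.H ◁ p ⊗≫ X ◁ Y ◁ p ⊗≫ 𝟙 _ := by
        rw [flip_coact, whisker_exchange]; monoidal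
    _ = 𝟙 _ ⊗≫ K.ca X ▷ Y ▷ V ⊗≫ X ◁ ((β_ Y K.H).inv ≫ (β_ Y K.H).hom) ▷ V ⊗≫
          X ◁ (K.H ◁ K.ca Y ⊗≫ (β_ K.H Y).hom ▷ K.H ⊗≫ Y ◁ K.tau K.H) ▷ V ⊗≫
          X ◁ Y ◁ K.H ◁ p ⊗≫ X ◁ Y ◁ p ⊗≫ 𝟙 _ := by
        rw [Iso.inv_hom_id, ca_flip]; monoidal
    _ = _ := by rw [Iso.inv_hom_id]; monoidal

/-- The transformation `actEnd p` satisfies the first axiom of a module braiding if and only if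
`p` is associative. The reversed order of the two actions on the right-hand side of the axiom
shows up as a half-braiding of `H` with itself, which commutativity of `H` in the Drinfeld center
absorbs. -/
theorem actEnd_tensor_iff (p : K.H ⊗ V ⟶ V) :
    (∀ X Y, K.actEnd p (X ⊗ Y) =
      (β_ Y X).inv ▷ V ≫ (α_ Y X V).hom ≫ Y ◁ K.actEnd p X ≫ (α_ Y X V).inv ≫
      (β_ Y X).hom ▷ V ≫ (α_ X Y V).hom ≫ X ◁ K.actEnd p Y ≫ (α_ X Y V).inv) ↔
    K.mul ▷ V ≫ p = (α_ _ _ _).hom ≫ K.H ◁ p ≫ p := by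
  have aux : K.mul ▷ V ≫ p = (α_ _ _ _).hom ≫ K.H ◁ p ≫ p ↔
      (α_ _ _ _).inv ≫ K.mul ▷ V ≫ p =
        (α_ _ _ _).inv ≫ K.tau K.H ▷ V ≫ (α_ _ _ _).hom ≫ K.H ◁ p ≫ p := by
    have : IsIso (K.tau K.H) := (K.halfBraiding.β K.H).isIso_inv
    rw [cancel_epi, ← cancel_epi (K.tau K.H ▷ V), ← comp_whiskerRight_assoc, tau_mul]
  rw [aux]
  refine ⟨fun h => K.ext_flip_two fun Y => K.ext_strong fun X => ?_, fun h X Y => ?_⟩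
  · have hXY := h X Y
    rwa [actEnd_tensor_eq, braided_actEnd_eq, cancel_epi, cancel_mono] at hXY
  · rw [actEnd_tensor_eq, braided_actEnd_eq, h]

theorem actEnd_tensorUnit (p : K.H ⊗ V ⟶ V) :
    K.actEnd p (𝟙_ B) = (K.unit ▷ V ≫ p) ≫ (λ_ V).inv := by
  unfold actEnd unit
  monoidal

theorem actEnd_tensorUnit_eq_id_iff (p : K.H ⊗ V ⟶ V) :
    K.actEnd p (𝟙_ B) = 𝟙 _ ↔ K.unit ▷ V ≫ p = (λ_ V).hom := by
  rw [actEnd_tensorUnit, Iso.comp_inv_eq, Category.id_comp]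

theorem actEnd_comp (p q : K.H ⊗ V ⟶ V) (X : B) : K.actEnd p X ≫ K.actEnd q X =
    K.actEnd (K.comul ▷ V ≫ (α_ _ _ _).hom ≫ K.H ◁ p ≫ q) X := by
  unfold actEnd
  calc _ = 𝟙 _ ⊗≫ K.ca X ▷ V ⊗≫ (X ◁ p ≫ K.ca X ▷ V) ⊗≫ X ◁ q := by monoidal
    _ = 𝟙 _ ⊗≫ (K.ca X ≫ K.ca X ▷ K.H ≫ (α_ _ _ _).hom) ▷ V ⊗≫ X ◁ K.H ◁ p ⊗≫ X ◁ q := by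
        rw [whisker_exchange]; monoidal
    _ = _ := by rw [← ca_comul]; monoidal

theorem actEnd_counit (X : B) : K.actEnd (K.counit ▷ V ≫ (λ_ V).hom) X = 𝟙 _ := by
  unfold actEnd
  calc _ = (K.ca X ≫ X ◁ K.counit) ▷ V ⊗≫ 𝟙 _ := by monoidal
    _ = _ := by rw [ca_counit]; monoidal

/-- If `H` has an antipode `S` and `p` is a left action of `H`, then `actEnd p` is invertible:
the inverse is given by the action precomposed with `S`. -/
theorem actEnd_isIso (hK : K.IsHopf) {p : K.H ⊗ V ⟶ V}
    (one : K.unit ▷ V ≫ p = (λ_ V).hom)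
    (mul : K.mul ▷ V ≫ p = (α_ _ _ _).hom ≫ K.H ◁ p ≫ p) (X : B) : IsIso (K.actEnd p X) := by
  obtain ⟨S, h1, h2⟩ := hK
  replace h1 : K.comul ≫ S ▷ K.H ≫ K.mul = K.counit ≫ K.unit := h1
  replace h2 : K.comul ≫ K.H ◁ S ≫ K.mul = K.counit ≫ K.unit := h2
  have e : (K.counit ≫ K.unit) ▷ V ≫ p = K.counit ▷ V ≫ (λ_ V).hom := by
    rw [comp_whiskerRight_assoc, one]
  refine ⟨K.actEnd (S ▷ V ≫ p) X, ?_, ?_⟩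
  · rw [actEnd_comp, ← actEnd_counit, ← e, ← h1]
    congr 1
    calc _ = K.comul ▷ V ≫ (α_ _ _ _).hom ≫ (K.H ◁ p ≫ S ▷ V) ≫ p := by monoidal
      _ = K.comul ▷ V ≫ S ▷ K.H ▷ V ≫ ((α_ _ _ _).hom ≫ K.H ◁ p ≫ p) := by
          rw [whisker_exchange]; monoidal
      _ = _ := by rw [← mul]; monoidal
  · rw [actEnd_comp, ← actEnd_counit, ← e, ← h2]
    congr 1
    calc _ = K.comul ▷ V ≫ (K.H ◁ S) ▷ V ≫ ((α_ _ _ _).hom ≫ K.H ◁ p ≫ p) := by monoidal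
      _ = _ := by rw [← mul]; monoidal

/-! ### Right actions of `H` by means of the half-braiding -/

/-- Through the half-braiding, associative right actions of `H` are the same as associative left
actions. Passing from one side to the other reverses the order of factors up to the half-braiding
of `H` with itself, so that this rests on commutativity of `H`. -/
theorem sig_assoc_iff (r : V ⊗ K.H ⟶ V) :
    K.mul ▷ V ≫ K.sig V ≫ r = (α_ _ _ _).hom ≫ K.H ◁ (K.sig V ≫ r) ≫ K.sig V ≫ r ↔
    V ◁ K.mul ≫ r = (α_ _ _ _).inv ≫ r ▷ K.H ≫ r := by
  have hs : ∀ Y, IsIso (K.sig Y) := fun Y => (K.halfBraiding.β Y).isIso_hom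
  have h1 : K.mul ▷ V ≫ K.sig V ≫ r = (α_ _ _ _).hom ≫ K.H ◁ K.sig V ≫ (α_ _ _ _).inv ≫
      K.sig V ▷ K.H ≫ (α_ _ _ _).hom ≫ V ◁ K.sig K.H ≫ V ◁ K.mul ≫ r := by
    rw [← Category.assoc, mul_sig]
    conv_lhs => rw [← sig_mul]
    monoidal
  have h2 : (α_ _ _ _).hom ≫ K.H ◁ (K.sig V ≫ r) ≫ K.sig V ≫ r =
      (α_ _ _ _).hom ≫ K.H ◁ K.sig V ≫ (α_ _ _ _).inv ≫
      K.sig V ▷ K.H ≫ (α_ _ _ _).hom ≫ V ◁ K.sig K.H ≫ (α_ _ _ _).inv ≫ r ▷ K.H ≫ r := by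
    rw [MonoidalCategory.whiskerLeft_comp, Category.assoc, reassoc_of% K.sig_nat r, sig_tensor]
    monoidal
  rw [h1, h2]
  iterate 6 rw [cancel_epi]

theorem sig_one_iff (r : V ⊗ K.H ⟶ V) :
    K.unit ▷ V ≫ K.sig V ≫ r = (λ_ V).hom ↔ V ◁ K.unit ≫ r = (ρ_ V).hom := by
  rw [← Category.assoc, unit_sig, Category.assoc, Category.assoc]
  conv_lhs => rhs; rw [← Category.comp_id (λ_ V).hom]
  rw [cancel_epi, Iso.inv_comp_eq, Category.comp_id]

/-- The endomorphism of `X ⊗ V` given by the coaction on `X`, the half-braiding, and a right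
action of `H` on `V` satisfies the second axiom of a module braiding. -/
theorem actEnd_action_right (r : V ⊗ K.H ⟶ V) (X Y : B) :
    K.actEnd (K.sig (Y ⊗ V) ≫ (α_ Y V K.H).hom ≫ Y ◁ r) X =
    (α_ X Y V).inv ≫ (β_ X Y).hom ▷ V ≫ (α_ Y X V).hom ≫ Y ◁ K.actEnd (K.sig V ≫ r) X ≫
      (α_ Y X V).inv ≫ (β_ Y X).hom ▷ V ≫ (α_ X Y V).hom := by
  unfold actEnd
  rw [sig_tensor]
  calc _ = 𝟙 _ ⊗≫ (K.ca X ▷ Y ⊗≫ X ◁ K.sig Y) ▷ V ⊗≫ X ◁ Y ◁ (K.sig V ≫ r) := by monoidal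
    _ = 𝟙 _ ⊗≫ (β_ X Y).hom ▷ V ⊗≫ Y ◁ K.ca X ▷ V ⊗≫
          ((β_ Y X).hom ▷ (K.H ⊗ V) ≫ (X ⊗ Y) ◁ (K.sig V ≫ r)) ⊗≫ 𝟙 _ := by
        rw [ca_sig]; monoidal
    _ = _ := by rw [← whisker_exchange]; monoidal

end StrongCoend

/-! ### Algebra maps into the twisted tensor product -/

section TwistedTensor

variable {B : Type u} [Category.{v} B] [MonoidalCategory B]
  (A : B) [MonObj A] {H : B} [MonObj H] (τ : HalfBraiding H) [CentralMonoid τ]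

theorem twistedInl_twistedInr_mul :
    twistedInl A τ ▷ H ≫ TwistedTensor A τ ◁ twistedInr A τ ≫ μ[TwistedTensor A τ] =
      𝟙 (A ⊗ H) := by
  change ((ρ_ A).inv ≫ A ◁ η[H]) ▷ H ≫ (A ⊗ H) ◁ ((λ_ H).inv ≫ η[A] ▷ H) ≫ twistedMul A τ = _
  unfold twistedMul
  rw [MonoidalCategory.tensorHom_def]
  calc _ = 𝟙 _ ⊗≫ A ◁ (η[H] ▷ (𝟙_ B ⊗ H) ≫ H ◁ (η[A] ▷ H)) ⊗≫ A ◁ (τ.β A).hom ▷ H ⊗≫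
        (μ[A] ▷ (H ⊗ H) ≫ A ◁ μ[H]) := by monoidal
    _ = 𝟙 _ ⊗≫ A ◁ η[A] ▷ H ⊗≫ A ◁ (η[H] ▷ A ≫ (τ.β A).hom) ▷ H ⊗≫
        (μ[A] ▷ (H ⊗ H) ≫ A ◁ μ[H]) := by rw [← whisker_exchange]; monoidal
    _ = 𝟙 _ ⊗≫ A ◁ η[A] ▷ H ⊗≫ ((A ⊗ A) ◁ (η[H] ▷ H) ≫ μ[A] ▷ (H ⊗ H)) ⊗≫ A ◁ μ[H] := by
        rw [CentralMonoid.one_comm]; monoidal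
    _ = 𝟙 _ ⊗≫ (A ◁ η[A] ≫ μ[A]) ▷ H ⊗≫ A ◁ (η[H] ▷ H ≫ μ[H]) := by
        rw [whisker_exchange]; monoidal
    _ = _ := by rw [MonObj.mul_one, MonObj.one_mul]; monoidal

theorem twistedInr_twistedInl_mul :
    twistedInr A τ ▷ A ≫ TwistedTensor A τ ◁ twistedInl A τ ≫ μ[TwistedTensor A τ] =
      (τ.β A).hom := by
  change ((λ_ H).inv ≫ η[A] ▷ H) ▷ A ≫ (A ⊗ H) ◁ ((ρ_ A).inv ≫ A ◁ η[H]) ≫ twistedMul A τ = _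
  unfold twistedMul
  rw [MonoidalCategory.tensorHom_def]
  calc _ = 𝟙 _ ⊗≫ η[A] ▷ (H ⊗ A) ⊗≫ A ◁ ((H ⊗ A) ◁ η[H] ≫ (τ.β A).hom ▷ H) ⊗≫
        (μ[A] ▷ (H ⊗ H) ≫ A ◁ μ[H]) := by monoidal
    _ = 𝟙 _ ⊗≫ (η[A] ▷ (H ⊗ A) ≫ A ◁ (τ.β A).hom) ⊗≫ ((A ⊗ A) ◁ (H ◁ η[H]) ≫
        μ[A] ▷ (H ⊗ H)) ⊗≫ A ◁ μ[H] := by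
        rw [whisker_exchange]; monoidal
    _ = 𝟙 _ ⊗≫ (τ.β A).hom ⊗≫ (η[A] ▷ A ≫ μ[A]) ▷ H ⊗≫ A ◁ (H ◁ η[H] ≫ μ[H]) := by
        rw [whisker_exchange, ← whisker_exchange]; monoidal
    _ = _ := by rw [MonObj.one_mul, MonObj.mul_one]; monoidal

instance : IsMonHom (twistedInr A τ) where
  one_hom := by
    change η[H] ≫ (λ_ H).inv ≫ η[A] ▷ H = (λ_ _).inv ≫ (η[A] ⊗ₘ η[H])
    rw [MonoidalCategory.tensorHom_def']; monoidal
  mul_hom := by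
    change μ[H] ≫ (λ_ H).inv ≫ η[A] ▷ H =
      (((λ_ H).inv ≫ η[A] ▷ H) ⊗ₘ ((λ_ H).inv ≫ η[A] ▷ H)) ≫ twistedMul A τ
    unfold twistedMul
    rw [MonoidalCategory.tensorHom_def, MonoidalCategory.tensorHom_def]
    symm
    calc (((λ_ H).inv ≫ η[A] ▷ H) ▷ H ≫ (A ⊗ H) ◁ ((λ_ H).inv ≫ η[A] ▷ H)) ≫ _ =
        𝟙 _ ⊗≫ η[A] ▷ (H ⊗ H) ⊗≫ A ◁ (H ◁ η[A] ≫ (τ.β A).hom) ▷ H ⊗≫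
        (μ[A] ▷ (H ⊗ H) ≫ A ◁ μ[H]) := by monoidal
      _ = 𝟙 _ ⊗≫ η[A] ▷ (H ⊗ H) ⊗≫ (A ◁ η[A] ≫ μ[A]) ▷ (H ⊗ H) ⊗≫ A ◁ μ[H] := by
        rw [τ.naturality, halfBraiding_unit]; monoidal
      _ = 𝟙 _ ⊗≫ (η[A] ▷ (H ⊗ H) ≫ A ◁ μ[H]) := by
        rw [MonObj.mul_one]; monoidal
      _ = _ := by rw [← whisker_exchange]; monoidal

end TwistedTensor

/-! ### Central actions and the reflective center -/

namespace StrongCoend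

variable {B : Type u} [Category.{v} B] [MonoidalCategory B] [BraidedCategory B]
  (K : StrongCoend B) {A : B} [MonObj A]

/-- A right action `r` of `H` on a right `A`-module `V` that combines with the action of `A` to an
action of the twisted tensor product `A ⊗_σ H`: acting by `H` and then by `A` is the same as
applying the half-braiding `H ⊗ A ⟶ A ⊗ H` and then acting by `A` and by `H`. -/
structure CentralAction (V : RMod A) (r : V.X ⊗ K.H ⟶ V.X) : Prop where
  one : V.X ◁ K.unit ≫ r = (ρ_ V.X).hom
  mul : V.X ◁ K.mul ≫ r = (α_ _ _ _).inv ≫ r ▷ K.H ≫ r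
  comm : r ▷ A ≫ V.act =
    (α_ _ _ _).hom ≫ V.X ◁ K.sig A ≫ (α_ _ _ _).inv ≫ V.act ▷ K.H ≫ r

variable {K}

/-- The endomorphisms of `X ⊗ V` given by a right action `r` of `H` are `A`-linear if and only if
`r` is compatible with the action of `A`. -/
theorem actEnd_linear_iff (V : RMod A) (r : V.X ⊗ K.H ⟶ V.X) :
    (∀ X, ((α_ X V.X A).hom ≫ X ◁ V.act) ≫ K.actEnd (K.sig V.X ≫ r) X =
      K.actEnd (K.sig V.X ≫ r) X ▷ A ≫ (α_ X V.X A).hom ≫ X ◁ V.act) ↔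
    r ▷ A ≫ V.act = (α_ _ _ _).hom ≫ V.X ◁ K.sig A ≫ (α_ _ _ _).inv ≫ V.act ▷ K.H ≫ r := by
  have hs : ∀ Y, IsIso (K.sig Y) := fun Y => (K.halfBraiding.β Y).isIso_hom
  have hl : ∀ X, ((α_ X V.X A).hom ≫ X ◁ V.act) ≫ K.actEnd (K.sig V.X ≫ r) X =
      (α_ X V.X A).hom ≫ (K.ca X ▷ (V.X ⊗ A) ⊗≫ X ◁ ((α_ _ _ _).inv ≫ K.sig V.X ▷ A ≫
        (α_ _ _ _).hom ≫ V.X ◁ K.sig A ≫ (α_ _ _ _).inv ≫ V.act ▷ K.H ≫ r)) := by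
    intro X
    unfold actEnd
    calc _ = (α_ X V.X A).hom ≫ (X ◁ V.act ≫ K.ca X ▷ V.X) ⊗≫ X ◁ (K.sig V.X ≫ r) := by monoidal
      _ = (α_ X V.X A).hom ≫ K.ca X ▷ (V.X ⊗ A) ⊗≫ X ◁ ((K.H ◁ V.act ≫ K.sig V.X) ≫ r) := by
        rw [whisker_exchange]; monoidal
      _ = _ := by rw [sig_nat, sig_tensor]; monoidal
  have hr : ∀ X, K.actEnd (K.sig V.X ≫ r) X ▷ A ≫ (α_ X V.X A).hom ≫ X ◁ V.act =
      (α_ X V.X A).hom ≫ (K.ca X ▷ (V.X ⊗ A) ⊗≫ X ◁ ((α_ _ _ _).inv ≫ K.sig V.X ▷ A ≫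
        r ▷ A ≫ V.act)) := by
    intro X
    unfold actEnd
    monoidal
  refine ⟨fun h => ?_, fun h X => by rw [hl, hr, h]⟩
  rw [← cancel_epi (K.sig V.X ▷ A), ← cancel_epi (α_ K.H V.X A).inv]
  refine K.ext_strong fun X => ?_
  have hX := h X
  rw [hl, hr, cancel_epi] at hX
  exact hX.symm

/-- The automorphisms of the modules `X ⊗ V` given by a central action of `H` on `V`. -/
def CentralAction.iso (hK : K.IsHopf) {V : RMod A} {r : V.X ⊗ K.H ⟶ V.X}
    (hr : K.CentralAction V r) (X : B) : V.tens X ≅ V.tens X :=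
  have : IsIso (K.actEnd (K.sig V.X ≫ r) X) :=
    actEnd_isIso hK ((sig_one_iff r).2 hr.one) ((sig_assoc_iff r).2 hr.mul) X
  let i : X ⊗ V.X ≅ X ⊗ V.X := asIso (K.actEnd (K.sig V.X ≫ r) X)
  RMod.mkIso i ((actEnd_linear_iff V r).2 hr.comm X)

/-- The object of the reflective center given by a module with a central action of `H`. -/
def CentralAction.toReflectiveCenter (hK : K.IsHopf) {V : RMod A} {r : V.X ⊗ K.H ⟶ V.X}
    (hr : K.CentralAction V r) : ReflectiveCenter B (RMod A) where
  obj := V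
  e := hr.iso hK
  naturality f := RMod.hom_ext (actEnd_naturality _ f)
  unit := RMod.hom_ext ((actEnd_tensorUnit_eq_id_iff _).2 ((sig_one_iff r).2 hr.one))
  tensor X Y := RMod.hom_ext ((actEnd_tensor_iff _).2 ((sig_assoc_iff r).2 hr.mul) X Y)

/-- The first axiom of a module braiding forces the component at the unit object to be idempotent;
being invertible, it is the identity. -/
theorem unit_act_of_isIso {V : B} {p : K.H ⊗ V ⟶ V} [IsIso (K.actEnd p (𝟙_ B))]
    (mul : K.mul ▷ V ≫ p = (α_ _ _ _).hom ≫ K.H ◁ p ≫ p) : K.unit ▷ V ≫ p = (λ_ V).hom := by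
  rw [← actEnd_tensorUnit_eq_id_iff, ← cancel_epi (K.actEnd p (𝟙_ B)), Category.comp_id,
    actEnd_tensorUnit]
  calc _ = 𝟙 _ ⊗≫ K.unit ▷ V ⊗≫ (𝟙_ B ◁ p ≫ K.unit ▷ V) ⊗≫ p ⊗≫ 𝟙 _ := by monoidal
    _ = 𝟙 _ ⊗≫ K.unit ▷ V ⊗≫ K.unit ▷ K.H ▷ V ⊗≫ ((α_ _ _ _).hom ≫ K.H ◁ p ≫ p) ⊗≫ 𝟙 _ := by
        rw [whisker_exchange]; monoidal
    _ = 𝟙 _ ⊗≫ K.unit ▷ V ⊗≫ (K.unit ▷ K.H ≫ K.mul) ▷ V ⊗≫ p ⊗≫ 𝟙 _ := by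
        rw [← mul]; monoidal
    _ = _ := by rw [unit_mul]; monoidal

open MonoidalLeftAction in
/-- Every family of automorphisms of the modules `X ⊗ V` that is natural in `X` and satisfies the
first axiom of a module braiding comes from a central action of `H` on `V`. -/
theorem exists_centralAction (V : RMod A) (e : ∀ X : B, (X ⊙ₗ V : RMod A) ≅ X ⊙ₗ V)
    (naturality : ∀ {X Y : B} (f : X ⟶ Y), f ⊵ₗ V ≫ (e Y).hom = (e X).hom ≫ f ⊵ₗ V)
    (tensor : ∀ X Y : B, (e (X ⊗ Y)).hom =
      (β_ Y X).inv ⊵ₗ V ≫ (αₗ Y X V).hom ≫ Y ⊴ₗ (e X).hom ≫ (αₗ Y X V).inv ≫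
      (β_ Y X).hom ⊵ₗ V ≫ (αₗ X Y V).hom ≫ X ⊴ₗ (e Y).hom ≫ (αₗ X Y V).inv) :
    ∃ r, K.CentralAction V r ∧ ∀ X, (e X).hom.hom = K.actEnd (K.sig V.X ≫ r) X := by
  obtain ⟨p, hp⟩ := exists_actEnd (K := K) (fun X => ((e X).hom.hom : X ⊗ V.X ⟶ X ⊗ V.X))
    fun f => congrArg RMod.Hom.hom (naturality f)
  obtain ⟨r, rfl⟩ : ∃ r, p = K.sig V.X ≫ r :=
    ⟨K.tau V.X ≫ p, by rw [← Category.assoc, sig_tau, Category.id_comp]⟩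
  have : IsIso (K.actEnd (K.sig V.X ≫ r) (𝟙_ B)) :=
    ⟨(e (𝟙_ B)).inv.hom, by
      rw [hp]; exact congrArg RMod.Hom.hom (e (𝟙_ B)).hom_inv_id, by
      rw [hp]; exact congrArg RMod.Hom.hom (e (𝟙_ B)).inv_hom_id⟩
  have mul := (actEnd_tensor_iff (K.sig V.X ≫ r)).1 fun X Y => by
    simp only [hp]
    exact congrArg RMod.Hom.hom (tensor X Y)
  refine ⟨r, ⟨(sig_one_iff r).1 (unit_act_of_isIso mul), (sig_assoc_iff r).1 mul,
    (actEnd_linear_iff V r).1 fun X => ?_⟩, fun X => (hp X).symm⟩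
  rw [hp]
  exact (e X).hom.act_hom

/-! ### Central actions from algebra maps -/

theorem coactBraid_eq {R : B} [MonObj R] (g : K.H ⟶ R) (X : B) (V : RMod R) :
    RMod.coactBraid K g X V = K.actEnd (K.sig V.X ≫ V.X ◁ g ≫ V.act) X := by
  unfold RMod.coactBraid actEnd
  rw [MonoidalCategory.whiskerLeft_comp, MonoidalCategory.whiskerLeft_comp]
  rfl

/-- If the images of algebra maps `i : A ⟶ R` and `g : H ⟶ R` commute up to the half-braiding, so
do the actions of `A` and `H` on an `R`-module. -/
theorem act_comm_of_mul_comm {R : B} [MonObj R] {i : A ⟶ R} {g : K.H ⟶ R}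
    (h : g ▷ A ≫ R ◁ i ≫ μ[R] = K.sig A ≫ i ▷ K.H ≫ R ◁ g ≫ μ[R]) (V : RMod R) :
    (V.X ◁ g ≫ V.act) ▷ A ≫ V.X ◁ i ≫ V.act =
    (α_ _ _ _).hom ≫ V.X ◁ K.sig A ≫ (α_ _ _ _).inv ≫ (V.X ◁ i ≫ V.act) ▷ K.H ≫
      V.X ◁ g ≫ V.act := by
  calc _ = 𝟙 _ ⊗≫ V.X ◁ g ▷ A ⊗≫ (V.act ▷ A ≫ V.X ◁ i) ≫ V.act := by monoidal
    _ = 𝟙 _ ⊗≫ V.X ◁ g ▷ A ⊗≫ V.X ◁ R ◁ i ⊗≫ ((α_ _ _ _).inv ≫ V.act ▷ R ≫ V.act) := by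
        rw [← whisker_exchange]; monoidal
    _ = 𝟙 _ ⊗≫ V.X ◁ (g ▷ A ≫ R ◁ i ≫ μ[R]) ≫ V.act := by rw [← V.act_mul]; monoidal
    _ = 𝟙 _ ⊗≫ V.X ◁ K.sig A ⊗≫ V.X ◁ i ▷ K.H ⊗≫ V.X ◁ R ◁ g ⊗≫ (V.X ◁ μ[R] ≫ V.act) := by
        rw [h]; monoidal
    _ = 𝟙 _ ⊗≫ V.X ◁ K.sig A ⊗≫ V.X ◁ i ▷ K.H ⊗≫ ((V.X ⊗ R) ◁ g ≫ V.act ▷ R) ≫ V.act := by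
        rw [V.act_mul]; monoidal
    _ = _ := by rw [whisker_exchange]; monoidal

theorem centralAction_of_algHom {f : K.H ⟶ A} [IsMonHom f]
    (h : f ▷ A ≫ μ[A] = K.sig A ≫ A ◁ f ≫ μ[A]) (V : RMod A) :
    K.CentralAction V (V.X ◁ f ≫ V.act) where
  one := ((RMod.restrict f).obj V).act_one
  mul := ((RMod.restrict f).obj V).act_mul
  comm := by simpa using act_comm_of_mul_comm (i := 𝟙 A) (by simpa using h) V

theorem centralAction_of_twistedTensor (M : RMod (TwistedTensor A K.halfBraiding)) :
    K.CentralAction ((RMod.restrict (twistedInl A K.halfBraiding)).obj M)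
      (M.X ◁ twistedInr A K.halfBraiding ≫ M.act) where
  one := ((RMod.restrict (twistedInr A K.halfBraiding)).obj M).act_one
  mul := ((RMod.restrict (twistedInr A K.halfBraiding)).obj M).act_mul
  comm := act_comm_of_mul_comm (by
    rw [twistedInr_twistedInl_mul, twistedInl_twistedInr_mul]
    exact (Category.comp_id (K.sig A)).symm) M

end StrongCoend

/-! ### Module braidings on the category of modules -/

namespace StrongCoend

open MonoidalLeftAction

variable {B : Type u} [Category.{v} B] [MonoidalCategory B] [BraidedCategory B]
  {K : StrongCoend B} {A : B} [MonObj A]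

theorem coactBraid_naturality {R : B} [MonObj R] (g : K.H ⟶ R) (X : B) {V W : RMod R}
    (k : V ⟶ W) : X ◁ k.hom ≫ RMod.coactBraid K g X W = RMod.coactBraid K g X V ≫ X ◁ k.hom := by
  rw [coactBraid_eq, coactBraid_eq]
  unfold actEnd
  calc _ = (X ◁ k.hom ≫ K.ca X ▷ W.X) ⊗≫ X ◁ K.sig W.X ⊗≫ X ◁ W.X ◁ g ⊗≫ X ◁ W.act := by monoidal
    _ = K.ca X ▷ V.X ⊗≫ X ◁ (K.H ◁ k.hom ≫ K.sig W.X) ⊗≫ X ◁ W.X ◁ g ⊗≫ X ◁ W.act := by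
        rw [whisker_exchange]; monoidal
    _ = K.ca X ▷ V.X ⊗≫ X ◁ K.sig V.X ⊗≫ X ◁ (k.hom ▷ K.H ≫ W.X ◁ g) ⊗≫ X ◁ W.act := by
        rw [sig_nat]; monoidal
    _ = K.ca X ▷ V.X ⊗≫ X ◁ K.sig V.X ⊗≫ X ◁ V.X ◁ g ⊗≫ X ◁ (k.hom ▷ R ≫ W.act) := by
        rw [← whisker_exchange]; monoidal
    _ = _ := by rw [← k.act_hom]; monoidal

/-- The transformations `coactBraid` satisfy the second axiom of a module braiding. -/
theorem coactBraid_tens {R : B} [MonObj R] (g : K.H ⟶ R) (X Y : B) (V : RMod R) :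
    RMod.coactBraid K g X (V.tens Y) =
    (α_ X Y V.X).inv ≫ (β_ X Y).hom ▷ V.X ≫ (α_ Y X V.X).hom ≫ Y ◁ RMod.coactBraid K g X V ≫
      (α_ Y X V.X).inv ≫ (β_ Y X).hom ▷ V.X ≫ (α_ X Y V.X).hom := by
  rw [coactBraid_eq, coactBraid_eq, ← actEnd_action_right]
  change K.actEnd (K.sig (Y ⊗ V.X) ≫ (Y ⊗ V.X) ◁ g ≫ (α_ Y V.X R).hom ≫ Y ◁ V.act) X = _
  congr 2
  monoidal

variable (hK : K.IsHopf)

/-- The module braiding given by an algebra map `f : H ⟶ A` whose values commute with `A` up to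
the half-braiding. -/
def moduleBraiding (f : K.H ⟶ A) [hf : IsMonHom f]
    (h : f ▷ A ≫ μ[A] = K.sig A ≫ A ◁ f ≫ μ[A]) : ModuleBraiding B (RMod A) where
  e X V := (centralAction_of_algHom h V).iso hK X
  naturality_left k V := ((centralAction_of_algHom h V).toReflectiveCenter hK).naturality k
  naturality_right X V W k := RMod.hom_ext (by
    change X ◁ k.hom ≫ K.actEnd _ X = K.actEnd _ X ≫ X ◁ k.hom
    rw [← coactBraid_eq, ← coactBraid_eq, coactBraid_naturality])
  tensor_left X Y V := ((centralAction_of_algHom h V).toReflectiveCenter hK).tensor X Y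
  action_right X Y V := RMod.hom_ext (by
    have := coactBraid_tens f X Y V
    rw [coactBraid_eq, coactBraid_eq] at this
    exact this)

theorem moduleBraiding_e (f : K.H ⟶ A) [IsMonHom f]
    (h : f ▷ A ≫ μ[A] = K.sig A ≫ A ◁ f ≫ μ[A]) (X : B) (V : RMod A) :
    ((moduleBraiding hK f h).e X V).hom.hom = RMod.coactBraid K f X V :=
  (coactBraid_eq f X V).symm

variable (A) in
/-- The regular right module of an algebra `A`. -/
def regularModule : RMod A where
  X := A
  act := μ[A]
  act_one := MonObj.mul_one A
  act_mul := by rw [MonObj.mul_assoc, Iso.inv_hom_id_assoc]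

/-- The action `V ⊗ A ⟶ V` as a morphism of modules from a free module. -/
def actHom (V : RMod A) : (regularModule A).tens V.X ⟶ V where
  hom := V.act
  act_hom := by
    change ((α_ V.X A A).hom ≫ V.X ◁ μ[A]) ≫ V.act = V.act ▷ A ≫ V.act
    rw [Category.assoc, V.act_mul, Iso.hom_inv_id_assoc]

/-- An algebra map `H ⟶ A` is determined by the transformations that it induces on the regular
module. -/
theorem coactBraid_injective {f g : K.H ⟶ A}
    (h : ∀ X, RMod.coactBraid K f X (regularModule A) = RMod.coactBraid K g X (regularModule A)) :
    f = g := by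
  have : IsIso (K.sig A) := (K.halfBraiding.β A).isIso_hom
  have h1 : K.sig A ≫ A ◁ f ≫ μ[A] = K.sig A ≫ A ◁ g ≫ μ[A] :=
    actEnd_injective fun X => by
      have hX := h X
      rw [coactBraid_eq, coactBraid_eq] at hX
      exact hX
  rw [cancel_epi] at h1
  have h2 : ∀ f : K.H ⟶ A, (λ_ K.H).inv ≫ η[A] ▷ K.H ≫ A ◁ f ≫ μ[A] = f := by
    intro f
    rw [← whisker_exchange_assoc, MonObj.one_mul]
    simp
  rw [← h2 f, h1, h2]

/-- If right multiplication by `f : H ⟶ A` is a central action of `H` on the regular module of `A`,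
then `f` is an algebra map whose values commute with `A` up to the half-braiding: each axiom of the
action gives one of these properties by evaluation at the unit of `A`. -/
theorem algHom_of_centralAction {f : K.H ⟶ A}
    (h : K.CentralAction (regularModule A) (A ◁ f ≫ μ[A])) :
    IsMonHom f ∧ f ▷ A ≫ μ[A] = K.sig A ≫ A ◁ f ≫ μ[A] := by
  have one : A ◁ K.unit ≫ A ◁ f ≫ μ[A] = (ρ_ A).hom := h.one
  have mul : A ◁ K.mul ≫ A ◁ f ≫ μ[A] =
    (α_ _ _ _).inv ≫ (A ◁ f ≫ μ[A]) ▷ K.H ≫ A ◁ f ≫ μ[A] := h.mul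
  have comm : (A ◁ f ≫ μ[A]) ▷ A ≫ μ[A] =
    (α_ _ _ _).hom ≫ A ◁ K.sig A ≫ (α_ _ _ _).inv ≫ μ[A] ▷ K.H ≫ A ◁ f ≫ μ[A] := h.comm
  refine ⟨⟨?_, ?_⟩, ?_⟩
  · calc K.unit ≫ f = 𝟙 _ ⊗≫ K.unit ⊗≫ f ⊗≫ (λ_ A).hom := by monoidal
      _ = 𝟙 _ ⊗≫ K.unit ⊗≫ f ⊗≫ (η[A] ▷ A ≫ μ[A]) := by rw [MonObj.one_mul]
      _ = 𝟙 _ ⊗≫ (𝟙_ B ◁ (K.unit ≫ f) ≫ η[A] ▷ A) ≫ μ[A] := by monoidal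
      _ = 𝟙 _ ⊗≫ η[A] ▷ 𝟙_ B ⊗≫ (A ◁ K.unit ≫ A ◁ f ≫ μ[A]) := by
          rw [whisker_exchange]; monoidal
      _ = _ := by rw [one]; monoidal
  · change K.mul ≫ f = (f ⊗ₘ f) ≫ μ[A]
    calc K.mul ≫ f = 𝟙 _ ⊗≫ K.mul ⊗≫ f ⊗≫ (λ_ A).hom := by monoidal
      _ = 𝟙 _ ⊗≫ K.mul ⊗≫ f ⊗≫ (η[A] ▷ A ≫ μ[A]) := by rw [MonObj.one_mul]
      _ = 𝟙 _ ⊗≫ (𝟙_ B ◁ (K.mul ≫ f) ≫ η[A] ▷ A) ≫ μ[A] := by monoidal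
      _ = 𝟙 _ ⊗≫ η[A] ▷ (K.H ⊗ K.H) ⊗≫ (A ◁ K.mul ≫ A ◁ f ≫ μ[A]) := by
          rw [whisker_exchange]; monoidal
      _ = 𝟙 _ ⊗≫ (η[A] ▷ K.H ≫ A ◁ f) ▷ K.H ⊗≫ μ[A] ▷ K.H ⊗≫ A ◁ f ⊗≫ μ[A] := by
          rw [mul]; monoidal
      _ = 𝟙 _ ⊗≫ f ▷ K.H ⊗≫ (η[A] ▷ A ≫ μ[A]) ▷ K.H ⊗≫ A ◁ f ⊗≫ μ[A] := by
          rw [← whisker_exchange]; monoidal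
      _ = _ := by rw [MonObj.one_mul, MonoidalCategory.tensorHom_def]; monoidal
  · calc f ▷ A ≫ μ[A] = 𝟙 _ ⊗≫ f ▷ A ⊗≫ (η[A] ▷ A ≫ μ[A]) ▷ A ⊗≫ μ[A] := by
          rw [MonObj.one_mul]; monoidal
      _ = 𝟙 _ ⊗≫ (𝟙_ B ◁ f ≫ η[A] ▷ A) ▷ A ⊗≫ μ[A] ▷ A ⊗≫ μ[A] := by monoidal
      _ = 𝟙 _ ⊗≫ η[A] ▷ (K.H ⊗ A) ⊗≫ ((A ◁ f ≫ μ[A]) ▷ A ≫ μ[A]) := by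
          rw [whisker_exchange]; monoidal
      _ = 𝟙 _ ⊗≫ (η[A] ▷ (K.H ⊗ A) ≫ A ◁ K.sig A) ⊗≫ μ[A] ▷ K.H ⊗≫ A ◁ f ⊗≫ μ[A] := by
          rw [comm]; monoidal
      _ = 𝟙 _ ⊗≫ K.sig A ⊗≫ (η[A] ▷ A ≫ μ[A]) ▷ K.H ⊗≫ A ◁ f ⊗≫ μ[A] := by
          rw [← whisker_exchange]; monoidal
      _ = _ := by rw [MonObj.one_mul]; monoidal

/-- Every module braiding on the category of `A`-modules is given by an algebra map `H ⟶ A`. The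
map is read off from the regular module; the second axiom determines the braiding on the free
modules `V ⊗ A`, and naturality with respect to the action `V ⊗ A ⟶ V` determines it on `V`. -/
theorem exists_algHom (m : ModuleBraiding B (RMod A)) :
    ∃ f : K.H ⟶ A, (IsMonHom f ∧ f ▷ A ≫ μ[A] = K.sig A ≫ A ◁ f ≫ μ[A]) ∧
      ∀ X V, (m.e X V).hom.hom = RMod.coactBraid K f X V := by
  have hV : ∀ V : RMod A, _ := fun V => exists_centralAction (K := K) V (fun X => m.e X V)
    (fun f => m.naturality_left f V) (fun X Y => m.tensor_left X Y V)
  obtain ⟨r, hr, he⟩ := hV (regularModule A)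
  change A ⊗ K.H ⟶ A at r
  -- `s` is the action on `V` that corresponds to the components of `m` at `V`.
  have key : ∀ (V : RMod A) (s : V.X ⊗ K.H ⟶ V.X),
      (∀ X, (m.e X V).hom.hom = K.actEnd (K.sig V.X ≫ s) X) →
      s = V.X ◁ ((λ_ K.H).inv ≫ η[A] ▷ K.H ≫ r) ≫ V.act := by
    intro V s hs
    have hsig : IsIso (K.sig (V.X ⊗ A)) := (K.halfBraiding.β (V.X ⊗ A)).isIso_hom
    have h1 : K.sig (V.X ⊗ A) ≫ V.act ▷ K.H ≫ s =
        K.sig (V.X ⊗ A) ≫ (α_ V.X A K.H).hom ≫ V.X ◁ r ≫ V.act := by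
      refine K.ext_strong fun X => ?_
      have hact := congrArg RMod.Hom.hom (m.action_right X V.X (regularModule A))
      have hact' : (m.e X ((regularModule A).tens V.X)).hom.hom =
          K.actEnd (K.sig (V.X ⊗ A) ≫ (α_ V.X A K.H).hom ≫ V.X ◁ r) X := by
        rw [actEnd_action_right]
        refine hact.trans ?_
        rw [show K.actEnd (K.sig A ≫ r) X = _ from (he X).symm]
        rfl
      have hnat : X ◁ V.act ≫ K.actEnd (K.sig V.X ≫ s) X =
          K.actEnd (K.sig (V.X ⊗ A) ≫ (α_ V.X A K.H).hom ≫ V.X ◁ r) X ≫ X ◁ V.act :=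
        (congrArg (X ◁ V.act ≫ ·) (hs X)).symm.trans
          ((congrArg RMod.Hom.hom (m.naturality_right X (actHom V))).trans
            (congrArg (· ≫ X ◁ V.act) hact'))
      unfold actEnd at hnat
      calc _ = K.ca X ▷ (V.X ⊗ A) ⊗≫ X ◁ (K.H ◁ V.act ≫ K.sig V.X) ≫ X ◁ s := by
            rw [sig_nat]; monoidal
        _ = (K.ca X ▷ (V.X ⊗ A) ≫ (X ⊗ K.H) ◁ V.act) ⊗≫ X ◁ (K.sig V.X ≫ s) := by monoidal
        _ = X ◁ V.act ≫ K.ca X ▷ V.X ≫ (α_ X K.H V.X).hom ≫ X ◁ (K.sig V.X ≫ s) := by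
            rw [← whisker_exchange]; monoidal
        _ = _ := by rw [hnat]; monoidal
    -- The action `V ⊗ A ⟶ V` is split by the unit of `A`, so `h1` determines `s`.
    rw [cancel_epi] at h1
    calc s = ((ρ_ V.X).inv ≫ (V.X ◁ η[A] ≫ V.act)) ▷ K.H ≫ s := by rw [V.act_one]; simp
      _ = (ρ_ V.X).inv ▷ K.H ⊗≫ (V.X ◁ η[A]) ▷ K.H ≫ (V.act ▷ K.H ≫ s) := by monoidal
      _ = _ := by rw [h1]; monoidal
  refine ⟨(λ_ K.H).inv ≫ η[A] ▷ K.H ≫ r, ?_, fun X V => ?_⟩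
  · exact algHom_of_centralAction (key (regularModule A) r he ▸ hr)
  · obtain ⟨s, -, hs⟩ := hV V
    rw [coactBraid_eq, ← key V s hs, hs]

/-! ### Modules over the twisted tensor product -/

/-- An action of `A ⊗_σ H` is the action of `A` followed by the action of `H`. -/
theorem act_eq_of_twistedTensor (M : RMod (TwistedTensor A K.halfBraiding)) :
    M.act = (α_ M.X A K.H).inv ≫ (M.X ◁ twistedInl A K.halfBraiding ≫ M.act) ▷ K.H ≫
      M.X ◁ twistedInr A K.halfBraiding ≫ M.act := by
  have h : M.act = M.X ◁ (twistedInl A K.halfBraiding ▷ K.H ≫ TwistedTensor A K.halfBraiding ◁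
      twistedInr A K.halfBraiding ≫ μ[TwistedTensor A K.halfBraiding]) ≫ M.act := by
    rw [twistedInl_twistedInr_mul]
    exact ((MonoidalCategory.whiskerLeft_id_assoc _ _ _)).symm
  refine h.trans ?_
  calc _ = M.X ◁ twistedInl A K.halfBraiding ▷ K.H ⊗≫ M.X ◁ TwistedTensor A K.halfBraiding ◁
        twistedInr A K.halfBraiding ⊗≫ (M.X ◁ μ[TwistedTensor A K.halfBraiding] ≫ M.act) := by
        monoidal
    _ = M.X ◁ twistedInl A K.halfBraiding ▷ K.H ⊗≫ ((M.X ⊗ TwistedTensor A K.halfBraiding) ◁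
        twistedInr A K.halfBraiding ≫ M.act ▷ TwistedTensor A K.halfBraiding) ⊗≫ M.act := by
        rw [M.act_mul]; monoidal
    _ = _ := by rw [whisker_exchange]; monoidal

/-- A module with a central action of `H`, as a module over the twisted tensor product. -/
def CentralAction.toModule {V : RMod A} {r : V.X ⊗ K.H ⟶ V.X} (hr : K.CentralAction V r) :
    RMod (TwistedTensor A K.halfBraiding) where
  X := V.X
  act := (α_ V.X A K.H).inv ≫ V.act ▷ K.H ≫ r
  act_one := by
    change V.X ◁ ((λ_ _).inv ≫ (η[A] ⊗ₘ K.unit)) ≫ (α_ V.X A K.H).inv ≫ V.act ▷ K.H ≫ r = _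
    rw [MonoidalCategory.tensorHom_def]
    calc _ = 𝟙 _ ⊗≫ V.X ◁ η[A] ▷ 𝟙_ B ⊗≫ ((V.X ⊗ A) ◁ K.unit ≫ V.act ▷ K.H) ⊗≫ r := by monoidal
      _ = 𝟙 _ ⊗≫ (V.X ◁ η[A] ≫ V.act) ▷ 𝟙_ B ⊗≫ (V.X ◁ K.unit ≫ r) := by
          rw [whisker_exchange]; monoidal
      _ = _ := by rw [V.act_one, hr.one]; monoidal
  act_mul := by
    change V.X ◁ ((α_ A K.H (A ⊗ K.H)).hom ≫ A ◁ (α_ K.H A K.H).inv ≫ A ◁ (K.sig A) ▷ K.H ≫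
      A ◁ (α_ A K.H K.H).hom ≫ (α_ A A (K.H ⊗ K.H)).inv ≫ (μ[A] ⊗ₘ K.mul)) ≫
      (α_ V.X A K.H).inv ≫ V.act ▷ K.H ≫ r = (α_ V.X (A ⊗ K.H) (A ⊗ K.H)).inv ≫
      ((α_ V.X A K.H).inv ≫ V.act ▷ K.H ≫ r) ▷ (A ⊗ K.H) ≫ (α_ V.X A K.H).inv ≫ V.act ▷ K.H ≫ r
    rw [MonoidalCategory.tensorHom_def]
    calc _ = 𝟙 _ ⊗≫ V.X ◁ A ◁ K.sig A ▷ K.H ⊗≫ V.X ◁ μ[A] ▷ (K.H ⊗ K.H) ⊗≫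
            ((V.X ⊗ A) ◁ K.mul ≫ V.act ▷ K.H) ⊗≫ r := by monoidal
      _ = 𝟙 _ ⊗≫ V.X ◁ A ◁ K.sig A ▷ K.H ⊗≫ (V.X ◁ μ[A] ≫ V.act) ▷ (K.H ⊗ K.H) ⊗≫
            (V.X ◁ K.mul ≫ r) := by rw [whisker_exchange]; monoidal
      _ = 𝟙 _ ⊗≫ ((V.X ⊗ A) ◁ K.sig A ≫ V.act ▷ (A ⊗ K.H)) ▷ K.H ⊗≫ V.act ▷ K.H ▷ K.H ⊗≫
            r ▷ K.H ⊗≫ r := by rw [V.act_mul, hr.mul]; monoidal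
      _ = 𝟙 _ ⊗≫ V.act ▷ (K.H ⊗ A ⊗ K.H) ⊗≫ ((α_ _ _ _).hom ≫ V.X ◁ K.sig A ≫ (α_ _ _ _).inv ≫
            V.act ▷ K.H ≫ r) ▷ K.H ⊗≫ r := by rw [whisker_exchange]; monoidal
      _ = _ := by rw [← hr.comm]; monoidal

theorem CentralAction.toModule_inl {V : RMod A} {r : V.X ⊗ K.H ⟶ V.X}
    (hr : K.CentralAction V r) :
    V.X ◁ twistedInl A K.halfBraiding ≫ hr.toModule.act = V.act := by
  change V.X ◁ ((ρ_ A).inv ≫ A ◁ K.unit) ≫ (α_ V.X A K.H).inv ≫ V.act ▷ K.H ≫ r = _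
  calc _ = 𝟙 _ ⊗≫ ((V.X ⊗ A) ◁ K.unit ≫ V.act ▷ K.H) ⊗≫ r := by monoidal
    _ = 𝟙 _ ⊗≫ V.act ▷ 𝟙_ B ⊗≫ (V.X ◁ K.unit ≫ r) := by rw [whisker_exchange]; monoidal
    _ = _ := by rw [hr.one]; monoidal

theorem CentralAction.toModule_inr {V : RMod A} {r : V.X ⊗ K.H ⟶ V.X}
    (hr : K.CentralAction V r) :
    V.X ◁ twistedInr A K.halfBraiding ≫ hr.toModule.act = r := by
  change V.X ◁ ((λ_ K.H).inv ≫ η[A] ▷ K.H) ≫ (α_ V.X A K.H).inv ≫ V.act ▷ K.H ≫ r = _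
  calc _ = 𝟙 _ ⊗≫ (V.X ◁ η[A] ≫ V.act) ▷ K.H ⊗≫ r := by monoidal
    _ = _ := by rw [V.act_one]; monoidal

theorem whiskerLeft_id_comm {X V : B} {k l : X ⊗ V ⟶ X ⊗ V} (h : k = l) :
    X ◁ 𝟙 V ≫ k = l ≫ X ◁ 𝟙 V := by
  rw [h, MonoidalCategory.whiskerLeft_id, Category.id_comp, Category.comp_id]

variable (A) in
/-- The functor from modules over the twisted tensor product `A ⊗_σ H` to the reflective center
of the category of `A`-modules. -/
def toReflectiveCenter :
    RMod (TwistedTensor A K.halfBraiding) ⥤ ReflectiveCenter B (RMod A) where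
  obj M := (centralAction_of_twistedTensor M).toReflectiveCenter hK
  map {M N} f := ⟨(RMod.restrict (twistedInl A K.halfBraiding)).map f, fun X => RMod.hom_ext (by
    have h := coactBraid_naturality (twistedInr A K.halfBraiding) X f
    rw [coactBraid_eq, coactBraid_eq] at h
    exact h)⟩

instance : (toReflectiveCenter A hK).Faithful where
  map_injective h := RMod.hom_ext (congrArg (fun k => k.hom.hom) h)

instance : (toReflectiveCenter A hK).Full where
  map_surjective {M N} k := by
    let g : M.X ⟶ N.X := k.hom.hom
    have hA : (M.X ◁ twistedInl A K.halfBraiding ≫ M.act) ≫ g =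
      g ▷ A ≫ N.X ◁ twistedInl A K.halfBraiding ≫ N.act := k.hom.act_hom
    -- The strong universal property turns compatibility with the braidings into `H`-linearity.
    have hH : (M.X ◁ twistedInr A K.halfBraiding ≫ M.act) ≫ g =
        g ▷ K.H ≫ N.X ◁ twistedInr A K.halfBraiding ≫ N.act := by
      have : IsIso (K.sig M.X) := (K.halfBraiding.β M.X).isIso_hom
      rw [← cancel_epi (K.sig M.X), ← reassoc_of% K.sig_nat g]
      refine K.ext_strong fun X => ?_
      have hX : X ◁ g ≫ K.actEnd (K.sig N.X ≫ N.X ◁ twistedInr A K.halfBraiding ≫ N.act) X =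
        K.actEnd (K.sig M.X ≫ M.X ◁ twistedInr A K.halfBraiding ≫ M.act) X ≫ X ◁ g :=
        congrArg RMod.Hom.hom (k.comm X)
      unfold actEnd at hX
      generalize M.X ◁ twistedInr A K.halfBraiding ≫ M.act = r at *
      generalize N.X ◁ twistedInr A K.halfBraiding ≫ N.act = s at *
      calc _ = (K.ca X ▷ M.X ≫ (α_ X K.H M.X).hom ≫ X ◁ (K.sig M.X ≫ r)) ≫ X ◁ g := by monoidal
        _ = (X ◁ g ≫ K.ca X ▷ N.X) ⊗≫ X ◁ (K.sig N.X ≫ s) := by rw [← hX]; monoidal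
        _ = _ := by rw [whisker_exchange]; monoidal
    -- Stated over `A ⊗ H`, to which `TwistedTensor A K.halfBraiding` unfolds.
    have linear : ∀ {a : M.X ⊗ A ⟶ M.X} {b : N.X ⊗ A ⟶ N.X} {r : M.X ⊗ K.H ⟶ M.X}
        {s : N.X ⊗ K.H ⟶ N.X}, a ≫ g = g ▷ A ≫ b → r ≫ g = g ▷ K.H ≫ s →
        ((α_ M.X A K.H).inv ≫ a ▷ K.H ≫ r) ≫ g =
          g ▷ (A ⊗ K.H) ≫ (α_ N.X A K.H).inv ≫ b ▷ K.H ≫ s := by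
      intro a b r s ha hr
      rw [Category.assoc, Category.assoc, hr, ← comp_whiskerRight_assoc, ha]
      monoidal
    exact ⟨⟨g, (congrArg (fun t : M.X ⊗ A ⊗ K.H ⟶ M.X => t ≫ g)
      (act_eq_of_twistedTensor M)).trans ((linear hA hH).trans
        (congrArg (fun t : N.X ⊗ A ⊗ K.H ⟶ N.X => g ▷ (A ⊗ K.H) ≫ t)
          (act_eq_of_twistedTensor N)).symm)⟩, rfl⟩

instance : (toReflectiveCenter A hK).EssSurj where
  mem_essImage W := by
    obtain ⟨r, hr, he⟩ := exists_centralAction (K := K) W.obj W.e W.naturality W.tensor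
    refine ⟨hr.toModule, ⟨ReflectiveCenter.mkIso (RMod.mkIso (Iso.refl W.obj.X) ?_) fun X =>
      RMod.hom_ext ?_⟩⟩
    · change (W.obj.X ◁ twistedInl A K.halfBraiding ≫ hr.toModule.act) ≫ 𝟙 W.obj.X =
        𝟙 W.obj.X ▷ A ≫ W.obj.act
      rw [hr.toModule_inl, id_whiskerRight, Category.id_comp]
      exact Category.comp_id W.obj.act
    · exact whiskerLeft_id_comm ((he X).trans
        (congrArg (fun t => K.actEnd (K.sig W.obj.X ≫ t) X) hr.toModule_inr).symm)

instance : (toReflectiveCenter A hK).IsEquivalence where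

/-- Compatibility of the functor with the actions of `Y`: the underlying isomorphism is an
identity. -/
def toReflectiveCenterActIso (Y : B) (M : RMod (TwistedTensor A K.halfBraiding)) :
    (Y ⊙ₗ (toReflectiveCenter A hK).obj M : ReflectiveCenter B (RMod A)) ≅
      (toReflectiveCenter A hK).obj (Y ⊙ₗ M) :=
  ReflectiveCenter.mkIso
    (RMod.mkIso (Iso.refl (Y ⊗ M.X)) (by
      change ((α_ Y M.X A).hom ≫ Y ◁ (M.X ◁ twistedInl A K.halfBraiding ≫ M.act)) ≫ 𝟙 (Y ⊗ M.X) =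
        𝟙 (Y ⊗ M.X) ▷ A ≫ (Y ⊗ M.X) ◁ twistedInl A K.halfBraiding ≫ (α_ Y M.X _).hom ≫ Y ◁ M.act
      monoidal))
    fun X => RMod.hom_ext (by
      have h := coactBraid_tens (twistedInr A K.halfBraiding) X Y M
      rw [coactBraid_eq, coactBraid_eq] at h
      exact whiskerLeft_id_comm h)

instance toReflectiveCenterLeftLinear : (toReflectiveCenter A hK).LeftLinear B where
  μₗ Y M := (toReflectiveCenterActIso hK Y M).hom
  δₗ Y M := (toReflectiveCenterActIso hK Y M).inv
  μₗ_comp_δₗ Y M := (toReflectiveCenterActIso hK Y M).hom_inv_id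
  δₗ_comp_μₗ Y M := (toReflectiveCenterActIso hK Y M).inv_hom_id
  μₗ_naturality_left {Y Y'} f M := by
    ext
    change f ▷ M.X ≫ 𝟙 _ = 𝟙 _ ≫ f ▷ M.X
    simp
  μₗ_naturality_right Y {M N} f := by
    ext
    change Y ◁ f.hom ≫ 𝟙 _ = 𝟙 _ ≫ Y ◁ f.hom
    simp
  μₗ_associativity Y Y' M := by
    ext
    change 𝟙 _ ≫ (α_ Y Y' M.X).hom = (α_ Y Y' M.X).hom ≫ Y ◁ 𝟙 (Y' ⊗ M.X) ≫ 𝟙 _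
    simp
  μₗ_unitality M := by
    ext
    change (λ_ M.X).hom = 𝟙 _ ≫ (λ_ M.X).hom
    simp
  δₗ_naturality_left {Y Y'} f M := by
    ext
    change f ▷ M.X ≫ 𝟙 _ = 𝟙 _ ≫ f ▷ M.X
    simp
  δₗ_naturality_right Y {M N} f := by
    ext
    change Y ◁ f.hom ≫ 𝟙 _ = 𝟙 _ ≫ Y ◁ f.hom
    simp
  δₗ_associativity Y Y' M := by
    ext
    change 𝟙 _ ≫ (α_ Y Y' M.X).hom = (α_ Y Y' M.X).hom ≫ 𝟙 _ ≫ Y ◁ 𝟙 (Y' ⊗ M.X)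
    simp
  δₗ_unitality_inv M := by
    ext
    change (λ_ M.X).inv = (λ_ M.X).inv ≫ 𝟙 _
    simp

end StrongCoend

end

theorem mainTheorem3 {B : Type u} [Category.{v} B] [MonoidalCategory B] [BraidedCategory B]
    (K : StrongCoend B) (hK : K.IsHopf) (A : B) [MonObj A] :
    (∃ Φ : {f : K.H ⟶ A // IsMonHom f ∧
          f ▷ A ≫ μ[A] = (K.halfBraiding.β A).hom ≫ A ◁ f ≫ μ[A]} ≃ ModuleBraiding B (RMod A),
      ∀ f X V, ((Φ f).e X V).hom.hom = RMod.coactBraid K f.1 X V) ∧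
    (∃ (E : RMod (TwistedTensor A K.halfBraiding) ≌ ReflectiveCenter B (RMod A))
        (_ : E.functor.LeftLinear B)
        (θ : E.functor ⋙ ReflectiveCenter.forget B (RMod A) ≅
          RMod.restrict (twistedInl A K.halfBraiding)),
      (∀ (Y : B) (M : RMod (TwistedTensor A K.halfBraiding)),
        (Functor.LaxLeftLinear.μₗ E.functor Y M).hom.hom ≫
            (θ.hom.app (MonoidalLeftActionStruct.actionObj Y M)).hom =
          Y ◁ (θ.hom.app M).hom) ∧
      ∀ (X : B) (M : RMod (TwistedTensor A K.halfBraiding)),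
        ((E.functor.obj M).e X).hom.hom ≫ X ◁ (θ.hom.app M).hom =
          X ◁ (θ.hom.app M).hom ≫ RMod.coactBraid K (twistedInr A K.halfBraiding) X M) := by
  refine ⟨⟨Equiv.ofBijective (fun f => StrongCoend.moduleBraiding (hf := f.2.1) hK f.1 f.2.2)
    ⟨fun f g h => ?_, fun m => ?_⟩, fun f X V => ?_⟩, ?_⟩
  · refine Subtype.ext (StrongCoend.coactBraid_injective fun X => ?_)
    have := f.2.1
    have := g.2.1
    rw [← StrongCoend.moduleBraiding_e hK f.1 f.2.2, ← StrongCoend.moduleBraiding_e hK g.1 g.2.2]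
    exact congrArg (fun m : ModuleBraiding B (RMod A) =>
      (m.e X (StrongCoend.regularModule A)).hom.hom) h
  · obtain ⟨f, hf, he⟩ := StrongCoend.exists_algHom (K := K) m
    have := hf.1
    refine ⟨⟨f, hf⟩, ?_⟩
    ext X V
    exact (StrongCoend.moduleBraiding_e hK f hf.2 X V).trans (he X V).symm
  · have := f.2.1
    exact StrongCoend.moduleBraiding_e hK f.1 f.2.2 X V
  · refine ⟨(StrongCoend.toReflectiveCenter A hK).asEquivalence,
      StrongCoend.toReflectiveCenterLeftLinear hK, Iso.refl _,
      fun Y M => ?_, fun X M => ?_⟩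
    · change 𝟙 (Y ⊗ M.X) ≫ 𝟙 (Y ⊗ M.X) = Y ◁ 𝟙 M.X
      simp
    · change K.actEnd _ X ≫ X ◁ 𝟙 M.X = X ◁ 𝟙 M.X ≫ _
      exact (StrongCoend.whiskerLeft_id_comm (StrongCoend.coactBraid_eq _ X M)).symm
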